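/- Let $X$ be a countable (finite or infinite) set and let $H_0$ be the operator on $\ell^2(X)$, $(H_0\psi)(x)=\sum_{y\in X}h(x,y)\psi(y)$, whose real matrix satisfies $h(x,y)=h(y,x)$, $h(x,y)\le 0$ for $x\ne y$, $\sum_{y}h(x,y)=0$ for every $x$, and $h(x,x)\le c_0$ for all $x$ with some constant $c_0$. Assume that $X$ is connected, i.e. it is not the disjoint union of two non-empty sets $X_1,X_2$ with $h(x_1,x_2)=0$ for all $x_1\in X_1$, $x_2\in X_2$. Let $p_0(t,x,y)$ be the kernel of the Markov semigroup $e^{-tH_0}$, and for $\lambda>0$ let $$R_\lambda(x,y)=-\int_0^\infty p_0(t,x,y)e^{-\lambda t}\,dt$$ be the kernel of the resolvent $(-H_0-\lambda)^{-1}$. Assume that the Markov process with the generator $-H_0$ is recurrent, i.e. $\int_0^\infty p_0(t,x,x)\,dt=\infty$ for all $x\in X$. Then: 1) For all $x,x_0\in X$ the finite limit $$\widetilde R(x,x_0)=\lim_{\lambda\to+0}\left[\frac{R_\lambda(x,x_0)^2}{R_\lambda(x_0,x_0)}-R_\lambda(x,x)\right]$$ exists; it is positive if $x\neq x_0$, and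 $\widetilde R(x_0,x_0)=0$. If $h$ is translation-invariant (i.e. the bijections $g$ of $X$ with $h(g(a),g(b))=h(a,b)$ for all $a,b\in X$ act transitively on $X$), then also $\widetilde R(x,x_0)=2\lim_{\lambda\to+0}[R_\lambda(x,x_0)-R_\lambda(x_0,x_0)]$. 2) Let $V:X\to[0,\infty)$ be arbitrary, let $H=H_0-V$ be the operator on $\ell^2(X)$ with the domain $\{\psi\in\ell^2(X):V\psi\in\ell^2(X)\}$, and let $N_0(V)\in\{0,1,2,\dots,\infty\}$ be the number of eigenvalues $\lambda_j\le 0$ of $H$, counted with multiplicity, where $N_0(V)=\infty$ if $H$ has essential spectrum in $(-\infty,0)$. Then for every $x_0\in X$ $$N_0(V)\le\sum_{x\in X}V(x)\widetilde R(x,x_0)+1,$$ $$N_0(V)\le\#\{x\in X: V(x)\ge 1\}+\sum_{x:\,V(x)<1}V(x)\widetilde R(x,x_0)+1,$$ where the right-hand sides may be infinite. -/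

import Mathlib

open Filter Topology MeasureTheory
open scoped ENNReal

namespace RecurrentCLR

/-- The complex Hilbert space `ℓ²(X)`. -/
abbrev L2 (X : Type*) : Type _ := lp (fun _ : X => ℂ) 2

/-- `h` is the matrix of `H₀`, where `-H₀` is a symmetric Markov generator on the connected
set `X` with bounded jump rates. -/
structure IsMarkovMatrix {X : Type*} (h : X → X → ℝ) : Prop where
  symm : ∀ x y, h x y = h y x
  offDiag_nonpos : ∀ x y, x ≠ y → h x y ≤ 0
  row_sum : ∀ x, HasSum (fun y => h x y) 0
  diag_bdd : ∃ c₀ : ℝ, ∀ x, h x x ≤ c₀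
  connected : ∀ S : Set X, S.Nonempty → Sᶜ.Nonempty → ∃ x ∈ S, ∃ y ∈ Sᶜ, h x y ≠ 0

namespace IsMarkovMatrix

variable {X : Type*} {h : X → X → ℝ}

/-- The rows of `h` are uniformly absolutely summable. -/
theorem exists_row_bound (hh : IsMarkovMatrix h) :
    ∃ C : ℝ, 0 ≤ C ∧ ∀ x, ∑' y, ENNReal.ofReal |h x y| ≤ ENNReal.ofReal C := by
  classical
  obtain ⟨c, hc⟩ := hh.diag_bdd
  refine ⟨2 * |c|, by positivity, fun x => ?_⟩
  have h1 : HasSum (fun y => (if y = x then 2 * h x x else 0) - h x y) (2 * h x x - 0) :=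
    (hasSum_ite_eq x (2 * h x x)).sub (hh.row_sum x)
  have hxx : 0 ≤ h x x := by
    have h2 := (hasSum_ite_eq x (h x x)).sub (hh.row_sum x)
    have := h2.nonneg (fun y => by
      by_cases hy : y = x
      · subst hy; simp
      · simpa [hy] using hh.offDiag_nonpos x y (Ne.symm hy))
    simpa using this
  have h2 : (fun y => (if y = x then 2 * h x x else 0) - h x y) = fun y => |h x y| := by
    funext y
    by_cases hy : y = x
    · subst hy; simp [abs_of_nonneg hxx]; ring
    · simp [hy, abs_of_nonpos (hh.offDiag_nonpos x y (Ne.symm hy))]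
  rw [h2, sub_zero] at h1
  rw [← ENNReal.ofReal_tsum_of_nonneg (fun y => abs_nonneg _) h1.summable, h1.tsum_eq]
  exact ENNReal.ofReal_le_ofReal (by linarith [hc x, le_abs_self c])

theorem summable_row (hh : IsMarkovMatrix h) (x : X) : Summable fun y => |h x y| :=
  (hh.row_sum x).summable.abs

theorem summable_row_mul (hh : IsMarkovMatrix h) (ψ : L2 X) (x : X) :
    Summable fun y => (h x y : ℂ) * ψ y := by
  refine Summable.of_norm_bounded (g := fun y => |h x y| * ‖ψ‖) ((hh.summable_row x).mul_right _)
    fun y => ?_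
  rw [norm_mul, Complex.norm_real, Real.norm_eq_abs]
  exact mul_le_mul_of_nonneg_left (lp.norm_apply_le_norm (by norm_num) ψ y) (abs_nonneg _)

/-- Cauchy-Schwarz in each row. -/
theorem row_sq_le (hh : IsMarkovMatrix h) {C : ℝ}
    (hC : ∀ x, ∑' y, ENNReal.ofReal |h x y| ≤ ENNReal.ofReal C) (ψ : L2 X) (x : X) :
    ENNReal.ofReal (‖∑' y, (h x y : ℂ) * ψ y‖ ^ 2) ≤
      ENNReal.ofReal C * ∑' y, ENNReal.ofReal |h x y| * ENNReal.ofReal (‖ψ y‖ ^ 2) := by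
  have hs := hh.summable_row_mul ψ x
  have ht : Tendsto (fun s : Finset X => ENNReal.ofReal (‖∑ y ∈ s, (h x y : ℂ) * ψ y‖ ^ 2)) atTop
      (𝓝 (ENNReal.ofReal (‖∑' y, (h x y : ℂ) * ψ y‖ ^ 2))) :=
    ENNReal.tendsto_ofReal ((hs.hasSum.norm).pow 2)
  refine le_of_tendsto' ht fun s => ?_
  have e1 : ‖∑ y ∈ s, (h x y : ℂ) * ψ y‖ ≤ ∑ y ∈ s, √|h x y| * (√|h x y| * ‖ψ y‖) := by
    refine (norm_sum_le _ _).trans (Finset.sum_le_sum fun y _ => ?_)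
    rw [norm_mul, Complex.norm_real, Real.norm_eq_abs, ← mul_assoc,
      Real.mul_self_sqrt (abs_nonneg _)]
  have e2 : ‖∑ y ∈ s, (h x y : ℂ) * ψ y‖ ^ 2 ≤
      (∑ y ∈ s, |h x y|) * ∑ y ∈ s, |h x y| * ‖ψ y‖ ^ 2 := by
    refine (pow_le_pow_left₀ (norm_nonneg _) e1 2).trans
      ((Finset.sum_mul_sq_le_sq_mul_sq _ _ _).trans_eq ?_)
    simp [mul_pow, Real.sq_sqrt]
  refine (ENNReal.ofReal_le_ofReal e2).trans ?_
  rw [ENNReal.ofReal_mul (Finset.sum_nonneg fun _ _ => abs_nonneg _),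
    ENNReal.ofReal_sum_of_nonneg (fun _ _ => abs_nonneg _),
    ENNReal.ofReal_sum_of_nonneg (fun _ _ => by positivity)]
  refine mul_le_mul' ((ENNReal.sum_le_tsum s).trans (hC x)) ?_
  refine le_trans (le_of_eq ?_) (ENNReal.sum_le_tsum s)
  exact Finset.sum_congr rfl fun y _ => ENNReal.ofReal_mul (abs_nonneg _)

/-- Schur test. -/
theorem tsum_sq_le (hh : IsMarkovMatrix h) {C : ℝ} (hC0 : 0 ≤ C)
    (hC : ∀ x, ∑' y, ENNReal.ofReal |h x y| ≤ ENNReal.ofReal C) (ψ : L2 X) :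
    ∑' x, ENNReal.ofReal (‖∑' y, (h x y : ℂ) * ψ y‖ ^ 2) ≤
      ENNReal.ofReal (C ^ 2 * ‖ψ‖ ^ 2) := by
  have hψ : ∑' y, ENNReal.ofReal (‖ψ y‖ ^ 2) = ENNReal.ofReal (‖ψ‖ ^ 2) := by
    have := lp.hasSum_norm (p := 2) (by norm_num) ψ
    simp only [ENNReal.toReal_ofNat, Real.rpow_two] at this
    rw [← ENNReal.ofReal_tsum_of_nonneg (fun y => by positivity) this.summable, this.tsum_eq]
  calc ∑' x, ENNReal.ofReal (‖∑' y, (h x y : ℂ) * ψ y‖ ^ 2)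
      ≤ ∑' x, ENNReal.ofReal C * ∑' y, ENNReal.ofReal |h x y| * ENNReal.ofReal (‖ψ y‖ ^ 2) :=
        ENNReal.tsum_le_tsum fun x => hh.row_sq_le hC ψ x
    _ = ENNReal.ofReal C * ∑' y, (∑' x, ENNReal.ofReal |h y x|) * ENNReal.ofReal (‖ψ y‖ ^ 2) := by
        rw [ENNReal.tsum_mul_left, ENNReal.tsum_comm]
        simp_rw [ENNReal.tsum_mul_right, hh.symm]
    _ ≤ ENNReal.ofReal C * ∑' y, ENNReal.ofReal C * ENNReal.ofReal (‖ψ y‖ ^ 2) := by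
        gcongr with y
        exact hC y
    _ = ENNReal.ofReal (C ^ 2 * ‖ψ‖ ^ 2) := by
        rw [ENNReal.tsum_mul_left, hψ, ← ENNReal.ofReal_mul hC0, ← ENNReal.ofReal_mul hC0]
        congr 1; ring

theorem summable_sq (hh : IsMarkovMatrix h) (ψ : L2 X) :
    Summable fun x => ‖∑' y, (h x y : ℂ) * ψ y‖ ^ 2 := by
  obtain ⟨C, hC0, hC⟩ := hh.exists_row_bound
  have h1 := ((hh.tsum_sq_le hC0 hC ψ).trans_lt ENNReal.ofReal_lt_top).ne
  refine (ENNReal.summable_toReal h1).congr fun x => ?_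
  rw [ENNReal.toReal_ofReal (by positivity)]

/-- The operator `(H₀ ψ)(x) = ∑ y, h(x,y) ψ(y)` as a linear map of `ℓ²(X)`. -/
noncomputable def H0Lin (hh : IsMarkovMatrix h) : L2 X →ₗ[ℂ] L2 X where
  toFun ψ := ⟨fun x => ∑' y, (h x y : ℂ) * ψ y,
    memℓp_gen (by simpa using hh.summable_sq ψ)⟩
  map_add' ψ φ := by
    ext x
    simp only [lp.coeFn_add, Pi.add_apply, mul_add]
    exact (hh.summable_row_mul ψ x).tsum_add (hh.summable_row_mul φ x)
  map_smul' c ψ := by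
    ext x
    simp only [lp.coeFn_smul, Pi.smul_apply, smul_eq_mul, RingHom.id_apply]
    rw [← tsum_mul_left]
    exact tsum_congr fun y => by ring

theorem exists_H0_bound (hh : IsMarkovMatrix h) : ∃ C : ℝ, ∀ ψ, ‖hh.H0Lin ψ‖ ≤ C * ‖ψ‖ := by
  obtain ⟨C, hC0, hC⟩ := hh.exists_row_bound
  refine ⟨C, fun ψ => ?_⟩
  refine lp.norm_le_of_tsum_le (by norm_num) (by positivity) ?_
  have h1 := hh.tsum_sq_le hC0 hC ψ
  rw [← ENNReal.ofReal_tsum_of_nonneg (fun y => by positivity) (hh.summable_sq ψ),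
    ENNReal.ofReal_le_ofReal_iff (by positivity)] at h1
  simpa [mul_pow, H0Lin] using h1

/-- The bounded operator `(H₀ ψ)(x) = ∑ y, h(x,y) ψ(y)` on `ℓ²(X)`. -/
noncomputable def H0 (hh : IsMarkovMatrix h) : L2 X →L[ℂ] L2 X :=
  hh.H0Lin.mkContinuousOfExistsBound hh.exists_H0_bound

theorem H0_apply (hh : IsMarkovMatrix h) (ψ : L2 X) (x : X) :
    hh.H0 ψ x = ∑' y, (h x y : ℂ) * ψ y := rfl

open Classical in
/-- The transition probability `p₀(t,x,y)`: the kernel of the Markov semigroup `exp(-t H₀)`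
(the kernel is real, since `h` is). -/
noncomputable def p0 (hh : IsMarkovMatrix h) (t : ℝ) (x y : X) : ℝ :=
  ((NormedSpace.exp ((-t : ℂ) • hh.H0)) (lp.single 2 y (1 : ℂ)) x).re

/-- The Markov process with the generator `-H₀` is recurrent: `∫₀^∞ p₀(t,x,x) dt = ∞`. -/
def IsRecurrent (hh : IsMarkovMatrix h) : Prop :=
  ∀ x, ∫⁻ t in Set.Ioi (0 : ℝ), ENNReal.ofReal (hh.p0 t x x) = ∞

/-- The kernel of the resolvent `(-H₀ - lam)⁻¹`, for `lam > 0`. -/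
noncomputable def R0 (hh : IsMarkovMatrix h) (lam : ℝ) (x y : X) : ℝ :=
  -∫ t in Set.Ioi (0 : ℝ), hh.p0 t x y * Real.exp (-lam * t)

/-- The renormalized resolvent
`R̃(x,x₀) = lim_{lam → +0} (R_lam(x,x₀)² / R_lam(x₀,x₀) - R_lam(x,x))`. -/
noncomputable def Rren (hh : IsMarkovMatrix h) (x x₀ : X) : ℝ :=
  limUnder (𝓝[>] (0 : ℝ)) fun lam => hh.R0 lam x x₀ ^ 2 / hh.R0 lam x₀ x₀ - hh.R0 lam x x

/-- The Schrödinger operator `H = H₀ - V` in `ℓ²(X)` with its natural domain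
`{ψ ∈ ℓ²(X) | V ψ ∈ ℓ²(X)}`. -/
noncomputable def schrodinger (hh : IsMarkovMatrix h) (V : X → ℝ) : L2 X →ₗ.[ℂ] L2 X where
  domain :=
    { carrier := {ψ | Memℓp (fun x => (V x : ℂ) * ψ x) 2}
      zero_mem' := by
        have : (fun x => (V x : ℂ) * (0 : L2 X) x) = 0 := by funext x; simp
        simp only [Set.mem_ofPred_eq, this]
        exact zero_memℓp
      add_mem' := fun {ψ φ} hψ hφ => by
        have := Memℓp.add hψ hφ
        refine (congrArg (fun f : X → ℂ => Memℓp f 2) ?_).mp this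
        funext x; simp [mul_add]
      smul_mem' := fun c ψ hψ => by
        have := Memℓp.const_smul hψ c
        refine (congrArg (fun f : X → ℂ => Memℓp f 2) ?_).mp this
        funext x; simp; ring }
  toFun :=
    { toFun := fun ψ => hh.H0 ψ - ⟨fun x => (V x : ℂ) * (ψ : L2 X) x, ψ.2⟩
      map_add' := fun ψ φ => by
        ext x
        change hh.H0 ((ψ : L2 X) + φ) x - (V x : ℂ) * ((ψ : L2 X) x + (φ : L2 X) x) =
          (hh.H0 ψ x - (V x : ℂ) * (ψ : L2 X) x) + (hh.H0 φ x - (V x : ℂ) * (φ : L2 X) x)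
        rw [map_add, lp.coeFn_add, Pi.add_apply]; ring
      map_smul' := fun c ψ => by
        ext x
        change hh.H0 (c • (ψ : L2 X)) x - (V x : ℂ) * (c * (ψ : L2 X) x) =
          c * (hh.H0 ψ x - (V x : ℂ) * (ψ : L2 X) x)
        rw [map_smul, lp.coeFn_smul, Pi.smul_apply, smul_eq_mul]; ring }

/-- The value `(H ψ)(x) = ∑ y, h(x,y) ψ(y) - V(x) ψ(x)`. -/
theorem schrodinger_apply (hh : IsMarkovMatrix h) (V : X → ℝ) (ψ : (hh.schrodinger V).domain)
    (x : X) : hh.schrodinger V ψ x = (∑' y, (h x y : ℂ) * (ψ : L2 X) y) - V x * (ψ : L2 X) x :=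
  rfl

end IsMarkovMatrix

section Counting

variable {E : Type*} [NormedAddCommGroup E] [InnerProductSpace ℂ E]

/-- The span of all eigenvectors of `A` with eigenvalues `μ ≤ 0`. For a symmetric operator its
dimension is the number of eigenvalues `μ ≤ 0` counted with multiplicity. -/
def nonposEigenspan (A : E →ₗ.[ℂ] E) : Submodule ℂ E :=
  Submodule.span ℂ {u | ∃ (μ : ℝ) (ψ : A.domain), μ ≤ 0 ∧ A ψ = (μ : ℂ) • (ψ : E) ∧ u = ψ}

/-- `μ` is in the essential spectrum of the self-adjoint operator `A` (Weyl's criterion). -/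
def IsEssentialSpectrum (A : E →ₗ.[ℂ] E) (μ : ℝ) : Prop :=
  ∃ u : ℕ → A.domain, Orthonormal ℂ (fun n => (u n : E)) ∧
    Tendsto (fun n => ‖A (u n) - (μ : ℂ) • (u n : E)‖) atTop (𝓝 0)

open Classical in
/-- The number of non-positive eigenvalues of the self-adjoint operator `A`, counted with
multiplicity; as usual, it is `∞` if `A` has essential spectrum below zero. -/
noncomputable def numNonposEigenvalues (A : E →ₗ.[ℂ] E) : ℕ∞ :=
  if ∃ μ < 0, IsEssentialSpectrum A μ then ⊤
  else Cardinal.toENat (Module.rank ℂ (nonposEigenspan A))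

end Counting

/-- `N₀(V)`, for the operator `H₀ - V`. -/
noncomputable def N0 {X : Type*} {h : X → X → ℝ} (hh : IsMarkovMatrix h) (V : X → ℝ) : ℕ∞ :=
  numNonposEigenvalues (hh.schrodinger V)

/-- `h` is invariant under a transitive group of bijections of `X` (for instance, under the
translations of `X`, if `X` is a group). -/
def IsTranslationInvariant {X : Type*} (h : X → X → ℝ) : Prop :=
  ∀ x y : X, ∃ g : Equiv.Perm X, (∀ a b, h (g a) (g b) = h a b) ∧ g x = y

end RecurrentCLR

namespace RecurrentCLR

open scoped ComplexConjugate InnerProductSpace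

/-! ### The quadratic form of `H₀` -/

namespace IsMarkovMatrix

variable {X : Type*} {h : X → X → ℝ}

/-! Since the rows of `h` sum to zero, the form of `H₀` is the Dirichlet form `E(ψ) = ∑ -h(x,y)/2 ·
|ψ x - ψ y|²` (`hasSum_energy`). The expression under the limit in `Rren` is the diagonal at `x` of
the Green function of `H₀ + lam` with a Dirichlet condition at `x₀`, so it is the squared norm of
evaluation at `x` on functions vanishing at `x₀`, for the form `E + lam‖·‖²`
(`exists_representing`). It grows as `lam` decreases and is bounded, because connectedness lets `E`
control every difference `ψ x - ψ x₀`. Hence the limit exists, and `|ψ x|² ≤ R̃(x,x₀) E(ψ)` whenever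
`ψ x₀ = 0` (`norm_sq_le_Rren_mul_energy`).

For the counting bounds, `n ≤ N₀(V)` yields an `n`-dimensional space on which `E(ψ) ≤ ∑ V|ψ|²`
(`exists_nonpos_subspace`). Requiring `ψ x₀ = 0` costs at most one dimension, the `+1` of the
bounds. On what remains, a basis `b i` diagonalizing `E` with values `μ i > 0` satisfies `1 ≤ ∑ₓ
V(x)|b i x|²/μ i`, while the pointwise inequality gives the Bessel bound `∑ᵢ |b i x|²/μ i ≤
R̃(x,x₀)`. Summing over `i` bounds the dimension (`finrank_le_tsum_of_vanishing`). For the second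
bound the functions must also vanish on `{V ≥ 1}`.

In the translation-invariant case, the two limits differ by a bounded quantity over `R_lam(x₀,x₀)`,
which diverges by recurrence. -/

theorem summable_norm_sq (ψ : L2 X) : Summable fun x => ‖ψ x‖ ^ 2 := by
  have := lp.hasSum_norm (p := 2) (by norm_num) ψ
  simp only [ENNReal.toReal_ofNat, Real.rpow_two] at this
  exact this.summable

/-- Follows from the uniform row bound. Together with its transpose, this majorant justifies every
rearrangement of the double sums below. -/
theorem summable_abs_mul_sq (hh : IsMarkovMatrix h) (ψ : L2 X) :
    Summable fun p : X × X => |h p.1 p.2| * ‖ψ p.1‖ ^ 2 := by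
  obtain ⟨C, hC0, hC⟩ := hh.exists_row_bound
  rw [summable_prod_of_nonneg (fun p => by positivity)]
  refine ⟨fun x => (hh.summable_row x).mul_right (‖ψ x‖ ^ 2), ?_⟩
  refine Summable.of_nonneg_of_le (fun x => tsum_nonneg fun y => by positivity) (fun x => ?_)
    ((summable_norm_sq ψ).mul_left C)
  have := hC x
  change ∑' y, |h x y| * ‖ψ x‖ ^ 2 ≤ C * ‖ψ x‖ ^ 2
  rw [tsum_mul_right]
  refine mul_le_mul_of_nonneg_right ?_ (by positivity)
  rwa [← ENNReal.ofReal_tsum_of_nonneg (fun y => abs_nonneg _) (hh.summable_row x),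
    ENNReal.ofReal_le_ofReal_iff hC0] at this

theorem summable_abs_mul_sq_snd (hh : IsMarkovMatrix h) (ψ : L2 X) :
    Summable fun p : X × X => |h p.1 p.2| * ‖ψ p.2‖ ^ 2 := by
  refine ((Equiv.prodComm X X).summable_iff.mpr (hh.summable_abs_mul_sq ψ)).congr fun p => ?_
  simp [hh.symm p.1 p.2]

theorem summable_form (hh : IsMarkovMatrix h) (ψ φ : L2 X) :
    Summable fun p : X × X => (h p.1 p.2 : ℂ) * (conj (ψ p.1) * φ p.2) := by
  refine Summable.of_norm_bounded ((hh.summable_abs_mul_sq ψ).add (hh.summable_abs_mul_sq_snd φ))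
    fun p => ?_
  rw [norm_mul, norm_mul, Complex.norm_real, Real.norm_eq_abs, RCLike.norm_conj, ← mul_add]
  refine mul_le_mul_of_nonneg_left ?_ (abs_nonneg _)
  nlinarith [sq_nonneg (‖ψ p.1‖ - ‖φ p.2‖), sq_nonneg ‖ψ p.1‖, sq_nonneg ‖φ p.2‖]

theorem hasSum_inner_H0 (hh : IsMarkovMatrix h) (ψ φ : L2 X) :
    HasSum (fun p : X × X => (h p.1 p.2 : ℂ) * (conj (ψ p.1) * φ p.2)) ⟪ψ, hh.H0 φ⟫_ℂ := by
  have h1 := (hh.summable_form ψ φ).hasSum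
  have h2 := h1.prod_fiberwise fun x => (h1.summable.prod_factor x).hasSum
  have h3 := lp.hasSum_inner (𝕜 := ℂ) ψ (hh.H0 φ)
  have h4 : (fun x => ∑' y, (h x y : ℂ) * (conj (ψ x) * φ y)) =
      fun x => inner ℂ (ψ x) (hh.H0 φ x) := by
    funext x
    rw [RCLike.inner_apply, H0_apply, ← tsum_mul_right]
    exact tsum_congr fun y => by ring
  simp only [h4] at h2
  rwa [h2.unique h3] at h1

theorem inner_H0_left (hh : IsMarkovMatrix h) (ψ φ : L2 X) :
    ⟪hh.H0 ψ, φ⟫_ℂ = ⟪ψ, hh.H0 φ⟫_ℂ := by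
  rw [← inner_conj_symm]
  have h1 := (Equiv.prodComm X X).hasSum_iff.mpr ((hh.hasSum_inner_H0 φ ψ).map
    (starRingEnd ℂ) Complex.continuous_conj)
  refine h1.unique ?_
  convert hh.hasSum_inner_H0 ψ φ using 1
  funext p
  simp [hh.symm p.1 p.2, mul_comm]

/-- The quadratic form of `H₀`. -/
noncomputable def energy (hh : IsMarkovMatrix h) (ψ : L2 X) : ℝ := (⟪ψ, hh.H0 ψ⟫_ℂ).re

theorem hasSum_mul_norm_sq (hh : IsMarkovMatrix h) (ψ : L2 X) :
    HasSum (fun p : X × X => h p.1 p.2 * ‖ψ p.1‖ ^ 2) 0 := by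
  have h1 : Summable (fun p : X × X => h p.1 p.2 * ‖ψ p.1‖ ^ 2) :=
    Summable.of_norm_bounded (hh.summable_abs_mul_sq ψ) fun p => by
      rw [norm_mul, Real.norm_eq_abs, Real.norm_of_nonneg (by positivity)]
  have h2 : HasSum (fun _ : X => (0 : ℝ)) (∑' p : X × X, h p.1 p.2 * ‖ψ p.1‖ ^ 2) :=
    h1.hasSum.prod_fiberwise fun x => by
      simpa only [zero_mul] using (hh.row_sum x).mul_right (‖ψ x‖ ^ 2)
  rw [← h2.unique hasSum_zero]
  exact h1.hasSum

/-- The sum of `h(x,y)|ψ x|²` over pairs is zero; subtracting the average of it and its transpose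
from `⟪ψ, H₀ ψ⟫` completes the square. -/
theorem hasSum_energy (hh : IsMarkovMatrix h) (ψ : L2 X) :
    HasSum (fun p : X × X => -h p.1 p.2 / 2 * ‖ψ p.1 - ψ p.2‖ ^ 2) (hh.energy ψ) := by
  have h1 := hh.hasSum_mul_norm_sq ψ
  have h2 := (Equiv.prodComm X X).hasSum_iff.mpr h1
  have h3 := Complex.hasSum_re (hh.hasSum_inner_H0 ψ ψ)
  have h4 := h3.sub ((h1.add h2).div_const 2)
  simp only [add_zero, zero_div, sub_zero] at h4
  suffices e : _ = _ from Eq.mpr (congrArg (fun f => HasSum f (hh.energy ψ)) e) h4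
  funext p
  simp only [Function.comp, Equiv.prodComm_apply, Prod.fst_swap, Prod.snd_swap, hh.symm p.2 p.1,
    Complex.sq_norm, Complex.normSq_apply, Complex.mul_re, Complex.sub_re, Complex.sub_im,
    Complex.ofReal_re, Complex.ofReal_im, Complex.conj_re, Complex.conj_im]
  ring

theorem energy_term_nonneg (hh : IsMarkovMatrix h) (ψ : L2 X) (p : X × X) :
    0 ≤ -h p.1 p.2 / 2 * ‖ψ p.1 - ψ p.2‖ ^ 2 := by
  by_cases hp : p.1 = p.2
  · simp [hp]
  · have := hh.offDiag_nonpos _ _ hp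
    have : 0 ≤ -h p.1 p.2 / 2 := by linarith
    positivity

theorem energy_nonneg (hh : IsMarkovMatrix h) (ψ : L2 X) : 0 ≤ hh.energy ψ :=
  (hh.hasSum_energy ψ).nonneg (hh.energy_term_nonneg ψ)

/-- The points admitting such a constant include `x₀`, and an edge with `h y z ≠ 0` passes the
property from `y` to `z`, so connectedness leaves no point out. -/
theorem exists_norm_sub_sq_le_energy (hh : IsMarkovMatrix h) (x x₀ : X) :
    ∃ C : ℝ, 0 ≤ C ∧ ∀ ψ : L2 X, ‖ψ x - ψ x₀‖ ^ 2 ≤ C * hh.energy ψ := by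
  set S : Set X := {x | ∃ C : ℝ, 0 ≤ C ∧ ∀ ψ : L2 X, ‖ψ x - ψ x₀‖ ^ 2 ≤ C * hh.energy ψ} with hS
  by_contra hx
  obtain ⟨y, ⟨C, hC0, hC⟩, z, hz, hyz⟩ := hh.connected S ⟨x₀, 0, le_rfl, by simp⟩ ⟨x, hx⟩
  refine hz ?_
  have hne : y ≠ z := by
    rintro rfl
    exact hz ⟨C, hC0, hC⟩
  have hneg : 0 < -h y z / 2 := by
    have := lt_of_le_of_ne (hh.offDiag_nonpos _ _ hne) hyz
    linarith
  -- From `(a + b)² ≤ 2a² + 2b²`: the single term `(y, z)` of the energy bounds `a = ‖ψ y - ψ z‖`,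
  -- and `C` bounds `b = ‖ψ y - ψ x₀‖`.
  refine ⟨2 * (1 / (-h y z / 2)) + 2 * C, by positivity, fun ψ => ?_⟩
  have h1 : -h y z / 2 * ‖ψ y - ψ z‖ ^ 2 ≤ hh.energy ψ :=
    le_hasSum (hh.hasSum_energy ψ) (y, z) fun p _ => hh.energy_term_nonneg ψ p
  have h2 : ‖ψ y - ψ z‖ ^ 2 ≤ 1 / (-h y z / 2) * hh.energy ψ := by
    rw [one_div, ← div_eq_inv_mul, le_div_iff₀ hneg]
    linarith
  have h3 : ‖ψ z - ψ x₀‖ ≤ ‖ψ y - ψ z‖ + ‖ψ y - ψ x₀‖ := by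
    rw [norm_sub_rev (ψ y) (ψ z)]
    exact norm_sub_le_norm_sub_add_norm_sub _ _ _
  have h4 := hC ψ
  nlinarith [sq_nonneg (‖ψ y - ψ z‖ - ‖ψ y - ψ x₀‖), norm_nonneg (ψ z - ψ x₀)]

theorem eq_zero_of_energy_eq_zero (hh : IsMarkovMatrix h) {ψ : L2 X} {x₀ : X}
    (hE : hh.energy ψ = 0) (h0 : ψ x₀ = 0) : ψ = 0 := by
  ext x
  obtain ⟨C, -, hC⟩ := hh.exists_norm_sub_sq_le_energy x x₀
  have := hC ψ
  rw [hE, h0, mul_zero, sub_zero] at this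
  simpa using le_antisymm this (by positivity)

/-! ### The heat semigroup -/

theorem isSelfAdjoint_H0 (hh : IsMarkovMatrix h) : IsSelfAdjoint hh.H0 :=
  ContinuousLinearMap.isSelfAdjoint_iff_isSymmetric.mpr fun ψ φ => hh.inner_H0_left ψ φ

open Classical in
/-- The vector `exp(-t H₀) δ_y`. -/
noncomputable def heat (hh : IsMarkovMatrix h) (y : X) (t : ℝ) : L2 X :=
  NormedSpace.exp ((-t : ℂ) • hh.H0) (lp.single 2 y (1 : ℂ))

theorem p0_eq (hh : IsMarkovMatrix h) (t : ℝ) (x y : X) : hh.p0 t x y = (hh.heat y t x).re := rfl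

open Classical in
theorem heat_zero (hh : IsMarkovMatrix h) (y : X) : hh.heat y 0 = lp.single 2 y (1 : ℂ) := by
  simp [heat]

theorem hasDerivAt_heat (hh : IsMarkovMatrix h) (y : X) (t : ℝ) :
    HasDerivAt (hh.heat y) (-hh.H0 (hh.heat y t)) t := by
  have h1 := hasDerivAt_exp_smul_const' (𝕂 := ℂ) hh.H0 (-(t : ℂ))
  have h2 : HasDerivAt (fun s : ℝ => -(s : ℂ)) (-1) t := (Complex.ofRealCLM.hasDerivAt (x := t)).neg
  have h3 := HasDerivAt.scomp t h1 h2
  classical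
  have h4 := ((ContinuousLinearMap.apply ℂ (L2 X) (lp.single 2 y (1 : ℂ) : L2 X)).restrictScalars
    ℝ).hasFDerivAt.comp_hasDerivAt t h3
  refine h4.congr_deriv ?_
  rw [neg_one_smul, map_neg]
  rfl

theorem continuous_heat (hh : IsMarkovMatrix h) (y : X) : Continuous (hh.heat y) :=
  continuous_iff_continuousAt.mpr fun t => (hh.hasDerivAt_heat y t).continuousAt

/-- The derivative of `‖exp(-t H₀) δ_y‖²` is minus twice the energy. -/
theorem norm_heat_le_one (hh : IsMarkovMatrix h) (y : X) {t : ℝ} (ht : 0 ≤ t) :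
    ‖hh.heat y t‖ ≤ 1 := by
  classical
  have h1 : ∀ t, HasDerivAt (fun s => ‖hh.heat y s‖ ^ 2) (-(2 * hh.energy (hh.heat y t))) t := by
    intro t
    have h2 := (hh.hasDerivAt_heat y t).inner ℂ (hh.hasDerivAt_heat y t)
    have h3 := Complex.reCLM.hasFDerivAt.comp_hasDerivAt t h2
    have e : (Complex.reCLM ∘ fun s => ⟪hh.heat y s, hh.heat y s⟫_ℂ) =
        fun s => ‖hh.heat y s‖ ^ 2 := by
      funext s
      simp [inner_self_eq_norm_sq_to_K, ← Complex.ofReal_pow]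
    rw [e] at h3
    refine h3.congr_deriv ?_
    · simp only [Complex.reCLM_apply, inner_neg_left, inner_neg_right, hh.inner_H0_left,
        Complex.add_re, Complex.neg_re, energy]
      ring
  have h2 : Antitone fun s => ‖hh.heat y s‖ ^ 2 :=
    antitone_of_deriv_nonpos (fun t => (h1 t).differentiableAt) fun t => by
      rw [(h1 t).deriv]
      have := hh.energy_nonneg (hh.heat y t)
      linarith
  have h3 : ‖hh.heat y t‖ ^ 2 ≤ ‖hh.heat y 0‖ ^ 2 := h2 ht
  rw [heat_zero, lp.norm_single (by norm_num), norm_one] at h3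
  exact (sq_le_sq₀ (norm_nonneg _) zero_le_one).mp h3

/-- With the self-adjoint half-time operator `A`, the diagonal value is `‖A δ_x‖²`. -/
theorem p0_self_nonneg (hh : IsMarkovMatrix h) (t : ℝ) (x : X) : 0 ≤ hh.p0 t x x := by
  classical
  set A := NormedSpace.exp ((-((t / 2 : ℝ) : ℂ)) • hh.H0) with hA
  have hs : IsSelfAdjoint A := by
    have : IsSelfAdjoint ((-((t / 2 : ℝ) : ℂ)) • hh.H0) := by
      refine IsSelfAdjoint.smul ?_ hh.isSelfAdjoint_H0
      simp [isSelfAdjoint_iff]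
    exact this.exp
  have h1 : NormedSpace.exp ((-t : ℂ) • hh.H0) = A * A := by
    let _ : NormedAlgebra ℚ (L2 X →L[ℂ] L2 X) := NormedAlgebra.restrictScalars ℚ ℂ _
    rw [hA, ← NormedSpace.exp_add_of_commute (Commute.refl _), ← add_smul]
    congr 2
    push_cast
    ring
  have h2 : hh.heat x t x = ⟪A (lp.single 2 x (1 : ℂ)), A (lp.single 2 x (1 : ℂ))⟫_ℂ := by
    have := lp.inner_single_left (𝕜 := ℂ) (G := fun _ : X => ℂ) x (1 : ℂ) (hh.heat x t)
    rw [RCLike.inner_apply, map_one, mul_one] at this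
    rw [← this, heat, h1]
    exact ((ContinuousLinearMap.isSelfAdjoint_iff_isSymmetric.mp hs) _ _).symm
  rw [p0_eq, h2]
  exact inner_self_nonneg (𝕜 := ℂ)

/-! ### The resolvent kernel -/

/-- The integrand `exp(-lam t) exp(-t H₀) δ_y` of the resolvent. -/
noncomputable def dampedHeat (hh : IsMarkovMatrix h) (lam : ℝ) (y : X) (t : ℝ) : L2 X :=
  (Real.exp (-lam * t) : ℂ) • hh.heat y t

theorem norm_dampedHeat_le (hh : IsMarkovMatrix h) (lam : ℝ) (y : X) {t : ℝ} (ht : 0 ≤ t) :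
    ‖hh.dampedHeat lam y t‖ ≤ Real.exp (-lam * t) := by
  rw [dampedHeat, norm_smul, Complex.norm_real, Real.norm_of_nonneg (Real.exp_pos _).le]
  exact mul_le_of_le_one_right (Real.exp_pos _).le (hh.norm_heat_le_one y ht)

theorem continuous_dampedHeat (hh : IsMarkovMatrix h) (lam : ℝ) (y : X) :
    Continuous (hh.dampedHeat lam y) := by
  have := hh.continuous_heat y
  unfold dampedHeat
  fun_prop

theorem integrableOn_dampedHeat (hh : IsMarkovMatrix h) {lam : ℝ} (hl : 0 < lam) (y : X) :
    IntegrableOn (hh.dampedHeat lam y) (Set.Ioi 0) := by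
  refine Integrable.mono' (exp_neg_integrableOn_Ioi 0 hl)
    (hh.continuous_dampedHeat lam y).aestronglyMeasurable ?_
  filter_upwards [ae_restrict_mem measurableSet_Ioi] with t ht
  exact hh.norm_dampedHeat_le lam y (le_of_lt ht)

/-- The vector `(H₀ + lam)⁻¹ δ_y`. -/
noncomputable def green (hh : IsMarkovMatrix h) (lam : ℝ) (y : X) : L2 X :=
  ∫ t in Set.Ioi (0 : ℝ), hh.dampedHeat lam y t

theorem hasDerivAt_dampedHeat (hh : IsMarkovMatrix h) (lam : ℝ) (y : X) (t : ℝ) :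
    HasDerivAt (hh.dampedHeat lam y)
      (-(hh.H0 + (lam : ℂ) • ContinuousLinearMap.id ℂ (L2 X)) (hh.dampedHeat lam y t)) t := by
  have h1 : HasDerivAt (fun s : ℝ => (Real.exp (-lam * s) : ℂ))
      ((Real.exp (-lam * t) * -lam : ℝ) : ℂ) t := by
    have := ((hasDerivAt_id t).const_mul (-lam)).exp.ofReal_comp
    simpa using this
  have h2 := h1.smul (hh.hasDerivAt_heat y t)
  refine h2.congr_deriv ?_
  change _ = -(hh.H0 (hh.dampedHeat lam y t) + (lam : ℂ) • hh.dampedHeat lam y t)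
  simp only [dampedHeat, map_smul, smul_neg, neg_add, smul_smul, Complex.ofReal_mul,
    Complex.ofReal_neg, mul_neg, neg_smul, mul_comm (lam : ℂ)]

-- The integrand's derivative is `-(H₀ + lam)` applied to it; integrating over `(0,∞)` leaves only
-- the boundary value `δ_y` at `t = 0`.
open Classical in
theorem H0_green (hh : IsMarkovMatrix h) {lam : ℝ} (hl : 0 < lam) (y : X) :
    hh.H0 (hh.green lam y) + (lam : ℂ) • hh.green lam y = lp.single 2 y (1 : ℂ) := by
  set L : L2 X →L[ℂ] L2 X := -(hh.H0 + (lam : ℂ) • ContinuousLinearMap.id ℂ (L2 X)) with hL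
  have hint := hh.integrableOn_dampedHeat hl y
  have h1 : Tendsto (hh.dampedHeat lam y) atTop (𝓝 0) := by
    refine squeeze_zero_norm' ((eventually_ge_atTop 0).mono fun t ht =>
      hh.norm_dampedHeat_le lam y ht) ?_
    refine Real.tendsto_exp_atBot.comp ?_
    exact tendsto_id.const_mul_atTop_of_neg (neg_lt_zero.mpr hl)
  have h2 := integral_Ioi_of_hasDerivAt_of_tendsto
    (hh.continuous_dampedHeat lam y).continuousWithinAt
    (fun t _ => hh.hasDerivAt_dampedHeat lam y t) (L.integrable_comp hint) h1
  have h3 := L.integral_comp_comm hint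
  have h4 : L (hh.green lam y) = 0 - hh.dampedHeat lam y 0 := h3.symm.trans h2
  change -(hh.H0 (hh.green lam y) + (lam : ℂ) • hh.green lam y) = _ at h4
  rw [zero_sub, neg_inj] at h4
  rw [h4, dampedHeat, heat_zero]
  simp

theorem R0_eq_neg_green_re (hh : IsMarkovMatrix h) {lam : ℝ} (hl : 0 < lam) (x y : X) :
    hh.R0 lam x y = -(hh.green lam y x).re := by
  have hint := hh.integrableOn_dampedHeat hl y
  have h1 := (Complex.reCLM.comp ((lp.evalCLM ℂ (fun _ : X => ℂ) 2 x).restrictScalars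
    ℝ)).integral_comp_comm hint
  rw [R0, neg_inj]
  refine Eq.trans (integral_congr_ae (Eventually.of_forall fun t => ?_)) h1
  change hh.p0 t x y * Real.exp (-lam * t) = (hh.dampedHeat lam y t x).re
  rw [dampedHeat, lp.coeFn_smul, Pi.smul_apply, smul_eq_mul, Complex.re_ofReal_mul, p0_eq, mul_comm]

theorem H0_star (hh : IsMarkovMatrix h) (ψ : L2 X) : hh.H0 (star ψ) = star (hh.H0 ψ) := by
  ext x
  rw [lp.star_apply, H0_apply, H0_apply, tsum_star]
  refine tsum_congr fun y => ?_
  simp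

theorem eq_zero_of_H0_add_smul (hh : IsMarkovMatrix h) {lam : ℝ} (hl : 0 < lam) {ψ : L2 X}
    (hψ : hh.H0 ψ + (lam : ℂ) • ψ = 0) : ψ = 0 := by
  have h1 : hh.energy ψ + lam * ‖ψ‖ ^ 2 = 0 := by
    have := congrArg (fun φ => (⟪ψ, φ⟫_ℂ).re) hψ
    simpa [inner_add_right, inner_smul_right, inner_self_eq_norm_sq_to_K, ← Complex.ofReal_pow,
      energy] using this
  have h2 := hh.energy_nonneg ψ
  have h3 : ‖ψ‖ ^ 2 = 0 := by
    have : 0 ≤ lam * ‖ψ‖ ^ 2 := by positivity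
    have : lam * ‖ψ‖ ^ 2 = 0 := by linarith
    simpa [hl.ne'] using this
  simpa using h3

/-- Both sides solve the same uniquely solvable equation, since `h` is real. This is needed because
`p0`, and so `R0`, records only real parts. -/
theorem star_green (hh : IsMarkovMatrix h) {lam : ℝ} (hl : 0 < lam) (y : X) :
    star (hh.green lam y) = hh.green lam y := by
  classical
  rw [← sub_eq_zero]
  refine hh.eq_zero_of_H0_add_smul hl ?_
  have h1 := hh.H0_green hl y
  have h2 := congrArg star h1
  have h3 : star (lp.single 2 y (1 : ℂ) : L2 X) = lp.single 2 y (1 : ℂ) := by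
    ext x
    rw [lp.star_apply, lp.single_apply]
    by_cases hx : x = y
    · subst hx; simp
    · simp [hx]
  rw [h3, star_add, star_smul, ← H0_star] at h2
  simp only [Complex.star_def, Complex.conj_ofReal] at h2
  rw [map_sub, smul_sub, sub_add_sub_comm, h1, h2, sub_self]

theorem green_apply (hh : IsMarkovMatrix h) {lam : ℝ} (hl : 0 < lam) (x y : X) :
    hh.green lam y x = ((-hh.R0 lam x y : ℝ) : ℂ) := by
  rw [hh.R0_eq_neg_green_re hl, neg_neg]
  have h1 : conj (hh.green lam y x) = hh.green lam y x := by
    conv_rhs => rw [← hh.star_green hl y, lp.star_apply]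
    rfl
  exact (Complex.conj_eq_iff_re.mp h1).symm

/-- Reproducing property of the resolvent kernel. -/
theorem inner_green (hh : IsMarkovMatrix h) {lam : ℝ} (hl : 0 < lam) (x : X) (ψ : L2 X) :
    ⟪hh.green lam x, hh.H0 ψ + (lam : ℂ) • ψ⟫_ℂ = ψ x := by
  classical
  have h1 := lp.inner_single_left (𝕜 := ℂ) (G := fun _ : X => ℂ) x (1 : ℂ) ψ
  rw [RCLike.inner_apply, map_one, mul_one, ← hh.H0_green hl x] at h1
  rw [← h1, inner_add_left, inner_add_right, inner_H0_left, inner_smul_left, inner_smul_right,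
    Complex.conj_ofReal]

theorem R0_symm (hh : IsMarkovMatrix h) {lam : ℝ} (hl : 0 < lam) (x y : X) :
    hh.R0 lam x y = hh.R0 lam y x := by
  classical
  have h1 := hh.inner_green hl x (hh.green lam y)
  rw [hh.H0_green hl, ← inner_conj_symm, lp.inner_single_left, RCLike.inner_apply, map_one,
    mul_one, hh.green_apply hl, hh.green_apply hl, Complex.conj_ofReal, Complex.ofReal_inj] at h1
  linarith

end IsMarkovMatrix

/-! ### Existence and positivity of the renormalized resolvent -/

theorem le_of_sq_le_mul_self {a C : ℝ} (ha : 0 ≤ a) (hC : 0 ≤ C) (h : a ^ 2 ≤ C * a) : a ≤ C := by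
  rcases ha.eq_or_lt with rfl | ha
  · exact hC
  · exact le_of_mul_le_mul_right (by rwa [sq] at h) ha

/-- Cauchy-Schwarz inequality for a non-negative symmetric operator. -/
theorem norm_inner_sq_le_of_nonneg {E : Type*} [NormedAddCommGroup E] [InnerProductSpace ℂ E]
    {T : E →ₗ[ℂ] E} (hT : T.IsSymmetric) (hpos : ∀ x, 0 ≤ (⟪x, T x⟫_ℂ).re) (x y : E) :
    ‖⟪x, T y⟫_ℂ‖ ^ 2 ≤ (⟪x, T x⟫_ℂ).re * (⟪y, T y⟫_ℂ).re := by
  set z := ⟪x, T y⟫_ℂ with hz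
  rcases eq_or_ne z 0 with h0 | h0
  · simpa [h0] using mul_nonneg (hpos x) (hpos y)
  have hzp : 0 < ‖z‖ ^ 2 := by positivity
  have hyx : ⟪y, T x⟫_ℂ = conj z := by
    rw [hz, inner_conj_symm, hT y x]
  -- This is the form at `y - t z x`; the factor `z` absorbs the phase, so a real parameter suffices
  -- for the discriminant argument.
  have hq : ∀ t : ℝ, 0 ≤ (‖z‖ ^ 2 * (⟪x, T x⟫_ℂ).re) * (t * t) + (-2 * ‖z‖ ^ 2) * t +
      (⟪y, T y⟫_ℂ).re := by
    intro t
    have h1 := hpos (y - ((t : ℂ) * z) • x)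
    have h2 : ⟪y - ((t : ℂ) * z) • x, T (y - ((t : ℂ) * z) • x)⟫_ℂ =
        ⟪y, T y⟫_ℂ - (t : ℂ) * (z * conj z) - (t : ℂ) * (conj z * z) +
          ((t * t : ℝ) : ℂ) * (conj z * z) * ⟪x, T x⟫_ℂ := by
      simp only [map_sub, map_smul, inner_sub_left, inner_sub_right, inner_smul_left,
        inner_smul_right, hyx, ← hz, map_mul, Complex.conj_ofReal]
      push_cast
      ring
    rw [h2] at h1
    rw [Complex.mul_conj, mul_comm (conj z), Complex.mul_conj, Complex.normSq_eq_norm_sq] at h1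
    simp only [← Complex.ofReal_mul, Complex.add_re, Complex.sub_re, Complex.ofReal_re,
      Complex.re_ofReal_mul] at h1
    linarith
  have h3 := discrim_le_zero hq
  rw [discrim] at h3
  have h4 : ‖z‖ ^ 2 * ‖z‖ ^ 2 ≤ ‖z‖ ^ 2 * ((⟪x, T x⟫_ℂ).re * (⟪y, T y⟫_ℂ).re) := by
    linarith
  exact le_of_mul_le_mul_left h4 hzp

namespace IsMarkovMatrix

variable {X : Type*} {h : X → X → ℝ}

/-- The prelimit expression of the renormalized resolvent. -/
noncomputable def preRen (hh : IsMarkovMatrix h) (x x₀ : X) (lam : ℝ) : ℝ :=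
  hh.R0 lam x x₀ ^ 2 / hh.R0 lam x₀ x₀ - hh.R0 lam x x

theorem re_inner_H0_add_smul (hh : IsMarkovMatrix h) (lam : ℝ) (ψ : L2 X) :
    (⟪ψ, hh.H0 ψ + (lam : ℂ) • ψ⟫_ℂ).re = hh.energy ψ + lam * ‖ψ‖ ^ 2 := by
  rw [inner_add_right, inner_smul_right, inner_self_eq_norm_sq_to_K, Complex.add_re, energy]
  simp [← Complex.ofReal_pow]

theorem norm_inner_H0_add_smul_sq_le (hh : IsMarkovMatrix h) {lam : ℝ} (hl : 0 < lam)
    (φ ψ : L2 X) : ‖⟪φ, hh.H0 ψ + (lam : ℂ) • ψ⟫_ℂ‖ ^ 2 ≤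
      (hh.energy φ + lam * ‖φ‖ ^ 2) * (hh.energy ψ + lam * ‖ψ‖ ^ 2) := by
  set T : L2 X →ₗ[ℂ] L2 X := hh.H0.toLinearMap + (lam : ℂ) • LinearMap.id
  have hT : ∀ ψ, T ψ = hh.H0 ψ + (lam : ℂ) • ψ := fun _ => rfl
  have h1 : T.IsSymmetric := fun φ ψ => by
    rw [hT, hT, inner_add_left, inner_add_right, inner_H0_left, inner_smul_left, inner_smul_right,
      Complex.conj_ofReal]
  have h2 : ∀ ψ, 0 ≤ (⟪ψ, T ψ⟫_ℂ).re := fun ψ => by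
    rw [hT, re_inner_H0_add_smul]
    have := hh.energy_nonneg ψ
    positivity
  rw [← re_inner_H0_add_smul, ← re_inner_H0_add_smul, ← hT, ← hT]
  exact norm_inner_sq_le_of_nonneg h1 h2 φ ψ

theorem R0_self_neg (hh : IsMarkovMatrix h) {lam : ℝ} (hl : 0 < lam) (x : X) :
    hh.R0 lam x x < 0 := by
  classical
  have h1 := hh.re_inner_H0_add_smul lam (hh.green lam x)
  rw [hh.inner_green hl, hh.green_apply hl, Complex.ofReal_re] at h1
  have h2 : hh.green lam x ≠ 0 := by
    intro h0
    have h3 := hh.H0_green hl x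
    rw [h0, map_zero, smul_zero, add_zero] at h3
    have h4 := congrArg (fun ψ : L2 X => ψ x) h3
    simp at h4
  have h3 := hh.energy_nonneg (hh.green lam x)
  have h4 : 0 < lam * ‖hh.green lam x‖ ^ 2 := by
    have := norm_pos_iff.mpr h2
    positivity
  linarith

/-- A representing vector, for the form of `H₀ + lam`, of the evaluation at `x` on the functions
that vanish at `x₀`. -/
theorem exists_representing (hh : IsMarkovMatrix h) {lam : ℝ} (hl : 0 < lam) (x x₀ : X) :
    ∃ φ : L2 X, φ x₀ = 0 ∧ φ x = (hh.preRen x x₀ lam : ℂ) ∧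
      hh.energy φ + lam * ‖φ‖ ^ 2 = hh.preRen x x₀ lam ∧
      ∀ ψ : L2 X, ψ x₀ = 0 → ⟪φ, hh.H0 ψ + (lam : ℂ) • ψ⟫_ℂ = ψ x := by
  -- The multiple of `green lam x₀` that cancels the value of `green lam x` at `x₀`.
  set c : ℝ := hh.R0 lam x x₀ / hh.R0 lam x₀ x₀ with hc
  have hne := (hh.R0_self_neg hl x₀).ne
  set φ : L2 X := hh.green lam x - (c : ℂ) • hh.green lam x₀ with hφ
  have e : ∀ y, φ y = ((-hh.R0 lam y x + c * hh.R0 lam y x₀ : ℝ) : ℂ) := by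
    intro y
    rw [hφ, lp.coeFn_sub, lp.coeFn_smul, Pi.sub_apply, Pi.smul_apply, smul_eq_mul,
      hh.green_apply hl, hh.green_apply hl]
    push_cast
    ring
  have h0 : φ x₀ = 0 := by
    rw [e, hh.R0_symm hl x₀ x, hc, div_mul_cancel₀ _ hne]
    simp
  have hx : φ x = (hh.preRen x x₀ lam : ℂ) := by
    rw [e, preRen, hc]
    congr 1
    ring
  have hr : ∀ ψ : L2 X, ψ x₀ = 0 → ⟪φ, hh.H0 ψ + (lam : ℂ) • ψ⟫_ℂ = ψ x := by
    intro ψ hψ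
    rw [hφ, inner_sub_left, inner_smul_left, hh.inner_green hl, hh.inner_green hl, hψ]
    simp
  refine ⟨φ, h0, hx, ?_, hr⟩
  rw [← re_inner_H0_add_smul, hr φ h0, hx, Complex.ofReal_re]

theorem preRen_nonneg (hh : IsMarkovMatrix h) {lam : ℝ} (hl : 0 < lam) (x x₀ : X) :
    0 ≤ hh.preRen x x₀ lam := by
  obtain ⟨φ, -, -, h1, -⟩ := hh.exists_representing hl x x₀
  have := hh.energy_nonneg φ
  rw [← h1]
  positivity

theorem norm_sq_le_preRen_mul (hh : IsMarkovMatrix h) {lam : ℝ} (hl : 0 < lam) {x x₀ : X}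
    {ψ : L2 X} (hψ : ψ x₀ = 0) :
    ‖ψ x‖ ^ 2 ≤ hh.preRen x x₀ lam * (hh.energy ψ + lam * ‖ψ‖ ^ 2) := by
  obtain ⟨φ, -, -, h1, h2⟩ := hh.exists_representing hl x x₀
  have := hh.norm_inner_H0_add_smul_sq_le hl φ ψ
  rwa [h1, h2 ψ hψ] at this

/-- The representing vector for the larger parameter is a test function for the smaller one; its
value at `x` equals its own squared form norm, so one factor cancels. -/
theorem antitoneOn_preRen (hh : IsMarkovMatrix h) (x x₀ : X) :
    AntitoneOn (hh.preRen x x₀) (Set.Ioi 0) := by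
  intro lam hl mu hm hlm
  obtain ⟨φ, h0, hx, h1, -⟩ := hh.exists_representing hm x x₀
  refine le_of_sq_le_mul_self (hh.preRen_nonneg hm x x₀) (hh.preRen_nonneg hl x x₀) ?_
  have h2 := hh.norm_sq_le_preRen_mul hl (x := x) h0
  rw [hx, Complex.norm_real, Real.norm_eq_abs, sq_abs] at h2
  refine h2.trans (mul_le_mul_of_nonneg_left ?_ (hh.preRen_nonneg hl x x₀))
  rw [← h1]
  gcongr

theorem exists_preRen_le (hh : IsMarkovMatrix h) (x x₀ : X) :
    ∃ C, ∀ lam > 0, hh.preRen x x₀ lam ≤ C := by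
  obtain ⟨C, hC0, hC⟩ := hh.exists_norm_sub_sq_le_energy x x₀
  refine ⟨C, fun lam hl => ?_⟩
  obtain ⟨φ, h0, hx, h1, -⟩ := hh.exists_representing hl x x₀
  refine le_of_sq_le_mul_self (hh.preRen_nonneg hl x x₀) hC0 ?_
  have h2 := hC φ
  rw [h0, sub_zero, hx, Complex.norm_real, Real.norm_eq_abs, sq_abs] at h2
  refine h2.trans (mul_le_mul_of_nonneg_left ?_ hC0)
  rw [← h1]
  have : 0 ≤ lam * ‖φ‖ ^ 2 := by positivity
  linarith

/-- By monotonicity and boundedness the limit is the supremum over `lam > 0`; existence of a limit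
is what gives `limUnder` in `Rren` its meaning. -/
theorem tendsto_preRen (hh : IsMarkovMatrix h) (x x₀ : X) :
    Tendsto (hh.preRen x x₀) (𝓝[>] 0) (𝓝 (hh.Rren x x₀)) := by
  obtain ⟨C, hC⟩ := hh.exists_preRen_le x x₀
  have hbdd : BddAbove (hh.preRen x x₀ '' Set.Ioi 0) := by
    refine ⟨C, ?_⟩
    rintro _ ⟨lam, hl, rfl⟩
    exact hC lam hl
  have h1 : Tendsto (hh.preRen x x₀) (𝓝[>] 0) (𝓝 (sSup (hh.preRen x x₀ '' Set.Ioi 0))) := by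
    refine tendsto_order.mpr ⟨fun a ha => ?_, fun a ha => ?_⟩
    · obtain ⟨_, ⟨mu, hm, rfl⟩, ha'⟩ := exists_lt_of_lt_csSup (Set.nonempty_Ioi.image _) ha
      filter_upwards [Ioo_mem_nhdsGT hm] with lam hl
      exact ha'.trans_le (hh.antitoneOn_preRen x x₀ hl.1 hm hl.2.le)
    · filter_upwards [self_mem_nhdsWithin] with lam hl
      exact (le_csSup hbdd ⟨lam, hl, rfl⟩).trans_lt ha
  exact tendsto_nhds_limUnder ⟨_, h1⟩

theorem Rren_nonneg (hh : IsMarkovMatrix h) (x x₀ : X) : 0 ≤ hh.Rren x x₀ :=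
  ge_of_tendsto (hh.tendsto_preRen x x₀)
    (by filter_upwards [self_mem_nhdsWithin] with lam hl using hh.preRen_nonneg hl x x₀)

theorem norm_sq_le_Rren_mul_energy (hh : IsMarkovMatrix h) (x : X) {x₀ : X} {ψ : L2 X}
    (hψ : ψ x₀ = 0) : ‖ψ x‖ ^ 2 ≤ hh.Rren x x₀ * hh.energy ψ := by
  have h1 : Tendsto (fun lam : ℝ => hh.energy ψ + lam * ‖ψ‖ ^ 2) (𝓝[>] 0) (𝓝 (hh.energy ψ)) := by
    have : Continuous fun lam : ℝ => hh.energy ψ + lam * ‖ψ‖ ^ 2 := by fun_prop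
    simpa using (this.tendsto 0).mono_left nhdsWithin_le_nhds
  refine ge_of_tendsto ((hh.tendsto_preRen x x₀).mul h1) ?_
  filter_upwards [self_mem_nhdsWithin] with lam hl using hh.norm_sq_le_preRen_mul hl hψ

theorem Rren_pos (hh : IsMarkovMatrix h) {x x₀ : X} (hx : x ≠ x₀) : 0 < hh.Rren x x₀ := by
  classical
  -- If `R̃(x,x₀)` were zero, the pointwise inequality would fail for `δ_x`, which vanishes at `x₀`.
  refine (hh.Rren_nonneg x x₀).lt_of_ne' fun h0 => ?_
  have h1 := hh.norm_sq_le_Rren_mul_energy x (ψ := lp.single 2 x (1 : ℂ)) (x₀ := x₀)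
    (by simp [hx.symm])
  rw [h0, zero_mul] at h1
  norm_num [lp.single_apply] at h1

theorem Rren_self (hh : IsMarkovMatrix h) (x₀ : X) : hh.Rren x₀ x₀ = 0 := by
  refine tendsto_nhds_unique (hh.tendsto_preRen x₀ x₀) (tendsto_const_nhds.congr fun lam => ?_)
  rw [preRen, sq, mul_self_div_self, sub_self]

/-! ### Recurrence and the translation-invariant formula -/

theorem exists_R0_diff_mem_Icc (hh : IsMarkovMatrix h) (x x₀ : X) :
    ∃ C, ∀ lam > 0, 2 * hh.R0 lam x x₀ - hh.R0 lam x x - hh.R0 lam x₀ x₀ ∈ Set.Icc 0 C := by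
  obtain ⟨C, hC0, hC⟩ := hh.exists_norm_sub_sq_le_energy x x₀
  refine ⟨C, fun lam hl => ?_⟩
  set D := 2 * hh.R0 lam x x₀ - hh.R0 lam x x - hh.R0 lam x₀ x₀ with hD
  -- This vector represents `ψ ↦ ψ x - ψ x₀`, so `D` is its squared form norm.
  set φ : L2 X := hh.green lam x - hh.green lam x₀ with hφ
  have h1 : φ x - φ x₀ = (D : ℂ) := by
    simp only [hφ, lp.coeFn_sub, Pi.sub_apply, hh.green_apply hl, hh.R0_symm hl x₀ x, hD]
    push_cast
    ring
  have h2 : hh.energy φ + lam * ‖φ‖ ^ 2 = D := by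
    rw [← re_inner_H0_add_smul]
    have hr : ∀ ψ, ⟪φ, hh.H0 ψ + (lam : ℂ) • ψ⟫_ℂ = ψ x - ψ x₀ := fun ψ => by
      rw [hφ, inner_sub_left, hh.inner_green hl, hh.inner_green hl]
    rw [hr, h1, Complex.ofReal_re]
  have h3 := hh.energy_nonneg φ
  have h4 : 0 ≤ lam * ‖φ‖ ^ 2 := by positivity
  have h5 : 0 ≤ D := by linarith
  refine ⟨h5, le_of_sq_le_mul_self h5 hC0 ?_⟩
  have h6 := hC φ
  rw [h1, Complex.norm_real, Real.norm_eq_abs, sq_abs] at h6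
  exact h6.trans (mul_le_mul_of_nonneg_left (by linarith) hC0)

/-- The pullback of `green lam (g y)` along `g` solves the equation that determines `green lam y`.
-/
theorem R0_equiv (hh : IsMarkovMatrix h) {lam : ℝ} (hl : 0 < lam) (g : Equiv.Perm X)
    (hg : ∀ a b, h (g a) (g b) = h a b) (x y : X) :
    hh.R0 lam (g x) (g y) = hh.R0 lam x y := by
  classical
  have hm : Memℓp (fun a => hh.green lam (g y) (g a)) 2 := memℓp_gen (by
    simpa [Function.comp_def] using
      (summable_norm_sq (hh.green lam (g y))).comp_injective g.injective)
  set ψ : L2 X := ⟨fun a => hh.green lam (g y) (g a), hm⟩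
  have hψa : ∀ a, ψ a = hh.green lam (g y) (g a) := fun _ => rfl
  have h1 : hh.H0 ψ + (lam : ℂ) • ψ = lp.single 2 y (1 : ℂ) := by
    ext a
    have h2 := congrArg (fun φ : L2 X => φ (g a)) (hh.H0_green hl (g y))
    simp only [lp.coeFn_add, lp.coeFn_smul, Pi.add_apply, Pi.smul_apply] at h2 ⊢
    have h3 : hh.H0 ψ a = hh.H0 (hh.green lam (g y)) (g a) := by
      rw [H0_apply, H0_apply, ← g.tsum_eq fun b => (h (g a) b : ℂ) * hh.green lam (g y) b]
      exact tsum_congr fun b => by rw [hg, hψa]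
    rw [h3, hψa, h2]
    by_cases ha : a = y
    · subst ha; simp
    · simp [ha]
  have h2 : ψ - hh.green lam y = 0 := by
    refine hh.eq_zero_of_H0_add_smul hl ?_
    rw [map_sub, smul_sub, sub_add_sub_comm, h1, hh.H0_green hl, sub_self]
  have h3 := hψa x
  rw [sub_eq_zero.mp h2, hh.green_apply hl, hh.green_apply hl, Complex.ofReal_inj] at h3
  linarith

theorem R0_self_eq (hh : IsMarkovMatrix h) (hinv : IsTranslationInvariant h) {lam : ℝ}
    (hl : 0 < lam) (x y : X) : hh.R0 lam x x = hh.R0 lam y y := by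
  obtain ⟨g, hg, rfl⟩ := hinv x y
  exact (hh.R0_equiv hl g hg x x).symm

theorem integrableOn_p0_mul_exp (hh : IsMarkovMatrix h) {lam : ℝ} (hl : 0 < lam) (x y : X) :
    IntegrableOn (fun t => hh.p0 t x y * Real.exp (-lam * t)) (Set.Ioi 0) := by
  refine ((Complex.reCLM.comp ((lp.evalCLM ℂ (fun _ : X => ℂ) 2 x).restrictScalars
    ℝ)).integrable_comp (hh.integrableOn_dampedHeat hl y)).congr (Eventually.of_forall fun t => ?_)
  change (hh.dampedHeat lam y t x).re = hh.p0 t x y * Real.exp (-lam * t)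
  rw [dampedHeat, lp.coeFn_smul, Pi.smul_apply, smul_eq_mul, Complex.re_ofReal_mul, p0_eq, mul_comm]

theorem continuous_p0 (hh : IsMarkovMatrix h) (x y : X) : Continuous fun t => hh.p0 t x y :=
  Complex.continuous_re.comp ((lp.evalCLM ℂ (fun _ : X => ℂ) 2 x).continuous.comp
    (hh.continuous_heat y))

/-- Fatou's lemma as `lam → +0`: the liminf of the damped integrals is at least `∫ p₀(t,x,x) dt =
∞`. -/
theorem tendsto_neg_R0_atTop (hh : IsMarkovMatrix h) (hrec : hh.IsRecurrent) (x : X) :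
    Tendsto (fun lam => -hh.R0 lam x x) (𝓝[>] 0) atTop := by
  rw [← ENNReal.tendsto_ofReal_nhds_top]
  have h1 : ∀ lam > 0, ENNReal.ofReal (-hh.R0 lam x x) =
      ∫⁻ t in Set.Ioi (0 : ℝ), ENNReal.ofReal (hh.p0 t x x * Real.exp (-lam * t)) := by
    intro lam hl
    rw [R0, neg_neg, ofReal_integral_eq_lintegral_ofReal (hh.integrableOn_p0_mul_exp hl x x)]
    exact Eventually.of_forall fun t => mul_nonneg (hh.p0_self_nonneg t x) (Real.exp_pos _).le
  have h2 : ∀ lam : ℝ, Measurable fun t => ENNReal.ofReal (hh.p0 t x x * Real.exp (-lam * t)) := by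
    intro lam
    have := hh.continuous_p0 x x
    exact (by fun_prop : Continuous fun t => hh.p0 t x x * Real.exp (-lam * t)).measurable.ennreal_ofReal
  have h3 := lintegral_liminf_le (μ := volume.restrict (Set.Ioi (0 : ℝ))) (u := 𝓝[>] (0 : ℝ)) h2
  have h4 : ∀ t, liminf (fun lam : ℝ => ENNReal.ofReal (hh.p0 t x x * Real.exp (-lam * t)))
      (𝓝[>] 0) = ENNReal.ofReal (hh.p0 t x x) := by
    intro t
    refine Tendsto.liminf_eq (ENNReal.tendsto_ofReal ?_)
    have : Continuous fun lam : ℝ => hh.p0 t x x * Real.exp (-lam * t) := by fun_prop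
    simpa using (this.tendsto 0).mono_left nhdsWithin_le_nhds
  simp only [h4] at h3
  rw [hrec x, top_le_iff] at h3
  refine tendsto_of_le_liminf_of_limsup_le ?_ le_top
  rw [← h3]
  refine (liminf_congr ?_).le
  filter_upwards [self_mem_nhdsWithin] with lam hl using (h1 lam hl).symm

/-- With `a = R_lam(x,x₀)` and `r = R_lam(x₀,x₀) = R_lam(x,x)`, one has `2(a - r) = (a²/r - r) + (a
- r)²/(-r)`; here `a - r` stays bounded and `-r → ∞`. -/
theorem tendsto_two_mul_R0_sub (hh : IsMarkovMatrix h) (hrec : hh.IsRecurrent)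
    (hinv : IsTranslationInvariant h) (x x₀ : X) :
    Tendsto (fun lam : ℝ => 2 * (hh.R0 lam x x₀ - hh.R0 lam x₀ x₀)) (𝓝[>] 0)
      (𝓝 (hh.Rren x x₀)) := by
  obtain ⟨C, hC⟩ := hh.exists_R0_diff_mem_Icc x x₀
  have h1 : Tendsto (fun lam : ℝ => (2 * (hh.R0 lam x x₀ - hh.R0 lam x₀ x₀)) ^ 2 / 4 /
      -hh.R0 lam x₀ x₀) (𝓝[>] 0) (𝓝 0) := by
    refine squeeze_zero' (g := fun lam => C ^ 2 / 4 / -hh.R0 lam x₀ x₀) ?_ ?_ ?_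
    · filter_upwards [self_mem_nhdsWithin] with lam hl
      have : 0 < -hh.R0 lam x₀ x₀ := neg_pos.mpr (hh.R0_self_neg hl x₀)
      positivity
    · filter_upwards [self_mem_nhdsWithin] with lam hl
      have h2 : 0 < -hh.R0 lam x₀ x₀ := neg_pos.mpr (hh.R0_self_neg hl x₀)
      have h3 := hC lam hl
      rw [hh.R0_self_eq hinv hl x x₀] at h3
      have h4 : 0 ≤ 2 * (hh.R0 lam x x₀ - hh.R0 lam x₀ x₀) := by linarith [h3.1]
      have h5 : 2 * (hh.R0 lam x x₀ - hh.R0 lam x₀ x₀) ≤ C := by linarith [h3.2]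
      gcongr
    · exact (hh.tendsto_neg_R0_atTop hrec x₀).const_div_atTop _
  have h2 := (hh.tendsto_preRen x x₀).add h1
  rw [add_zero] at h2
  refine h2.congr' ?_
  filter_upwards [self_mem_nhdsWithin] with lam hl
  have h3 := (hh.R0_self_neg hl x₀).ne
  rw [preRen, hh.R0_self_eq hinv hl x x₀]
  field_simp
  ring

/-! ### Dimension bounds for spaces on which the potential dominates the energy -/

/-- A finite-dimensional space of functions vanishing at a point has a basis that diagonalizes both
the scalar product and the energy. -/
theorem exists_orthonormal_energy (hh : IsMarkovMatrix h) (W : Submodule ℂ (L2 X))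
    [FiniteDimensional ℂ W] {x₀ : X} (hW : ∀ ψ ∈ W, ψ x₀ = 0) :
    ∃ (b : Fin (Module.finrank ℂ W) → L2 X) (μ : Fin (Module.finrank ℂ W) → ℝ),
      (∀ i, b i ∈ W) ∧ (∀ i, 0 < μ i) ∧ (∀ i, hh.energy (b i) = μ i) ∧
      ∀ c : Fin (Module.finrank ℂ W) → ℂ, hh.energy (∑ i, c i • b i) = ∑ i, μ i * ‖c i‖ ^ 2 := by
  classical
  -- The compression of `H₀` to `W`; its eigenvectors form the basis.
  set T : W →ₗ[ℂ] W := (W.orthogonalProjectionOnto.toLinearMap ∘ₗ hh.H0.toLinearMap) ∘ₗ W.subtype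
    with hTdef
  have hT : ∀ u v : W, ⟪u, T v⟫_ℂ = ⟪(u : L2 X), hh.H0 v⟫_ℂ := fun u v =>
    (Submodule.inner_orthogonalProjectionOnto_eq_of_mem_left u (hh.H0 v))
  have hsymm : T.IsSymmetric := fun u v => by
    rw [← inner_conj_symm, hT, inner_conj_symm, hT, inner_H0_left]
  set b := hsymm.eigenvectorBasis rfl with hb
  set μ := hsymm.eigenvalues rfl with hμ
  have hc : ∀ c : Fin (Module.finrank ℂ W) → ℂ,
      hh.energy (∑ i, c i • (b i : L2 X)) = ∑ i, μ i * ‖c i‖ ^ 2 := by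
    intro c
    have h1 : (∑ i, c i • (b i : L2 X)) = ((∑ i, c i • b i : W) : L2 X) := by simp
    have h2 : T (∑ i, c i • b i) = ∑ i, (c i * μ i) • b i := by
      rw [map_sum]
      refine Finset.sum_congr rfl fun i _ => ?_
      rw [map_smul, hb, hsymm.apply_eigenvectorBasis, smul_smul]
      rfl
    rw [energy, h1, ← hT, h2, b.orthonormal.inner_sum, Complex.re_sum]
    refine Finset.sum_congr rfl fun i _ => ?_
    rw [← mul_assoc, mul_comm (conj (c i)), Complex.mul_conj, ← Complex.ofReal_mul,
      Complex.ofReal_re, Complex.normSq_eq_norm_sq, mul_comm]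
  have he : ∀ i, hh.energy (b i) = μ i := by
    intro i
    have := hc (Pi.single i 1)
    simpa [Pi.single_apply, apply_ite norm, ite_pow] using this
  refine ⟨fun i => b i, μ, fun i => (b i).2, fun i => ?_, he, hc⟩
  -- Zero energy and vanishing at `x₀` force a zero vector, contradicting unit norm.
  refine ((hh.energy_nonneg (b i)).trans_eq (he i)).lt_of_ne' fun h0 => ?_
  have h1 := hh.eq_zero_of_energy_eq_zero ((he i).trans h0) (hW _ (b i).2)
  have h2 := b.orthonormal.1 i
  rw [← Submodule.norm_coe, h1, norm_zero] at h2
  exact zero_ne_one h2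

theorem finrank_le_tsum_of_vanishing (hh : IsMarkovMatrix h) {V : X → ℝ} (hV : ∀ x, 0 ≤ V x)
    (W : Submodule ℂ (L2 X)) [FiniteDimensional ℂ W] {x₀ : X} (hW : ∀ ψ ∈ W, ψ x₀ = 0)
    (hform : ∀ ψ ∈ W, ENNReal.ofReal (hh.energy ψ) ≤ ∑' x, ENNReal.ofReal (V x * ‖ψ x‖ ^ 2)) :
    (Module.finrank ℂ W : ℝ≥0∞) ≤ ∑' x, ENNReal.ofReal (V x * hh.Rren x x₀) := by
  obtain ⟨b, μ, hb, hμ, he, hc⟩ := hh.exists_orthonormal_energy W hW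
  have hbessel : ∀ x, ∑ i, (μ i)⁻¹ * ‖b i x‖ ^ 2 ≤ hh.Rren x x₀ := by
    intro x
    set s := ∑ i, (μ i)⁻¹ * ‖b i x‖ ^ 2 with hs
    have hs0 : 0 ≤ s := Finset.sum_nonneg fun i _ => by have := hμ i; positivity
    -- The extremal coefficients: `∑ c i • b i` has both energy and value at `x` equal to `s`, so
    -- the pointwise inequality reads `s² ≤ R̃(x,x₀) s`.
    set c : Fin (Module.finrank ℂ W) → ℂ := fun i => ((μ i)⁻¹ : ℝ) * conj (b i x) with hcdef
    have h1 := hc c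
    have h2 : ∑ i, μ i * ‖c i‖ ^ 2 = s := by
      refine Finset.sum_congr rfl fun i _ => ?_
      have := (hμ i).ne'
      rw [hcdef]
      simp only [norm_mul, Complex.norm_real, RCLike.norm_conj, mul_pow, Real.norm_eq_abs, sq_abs]
      field_simp
    have h3 : (∑ i, c i • b i) x = (s : ℂ) := by
      rw [lp.coeFn_sum, Finset.sum_apply, hs, Complex.ofReal_sum]
      refine Finset.sum_congr rfl fun i _ => ?_
      rw [lp.coeFn_smul, Pi.smul_apply, smul_eq_mul, hcdef]
      simp only [mul_assoc]
      rw [mul_comm (conj _), Complex.mul_conj, Complex.normSq_eq_norm_sq, Complex.ofReal_mul]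
    have h4 := hh.norm_sq_le_Rren_mul_energy x (x₀ := x₀) (ψ := ∑ i, c i • b i)
      (hW _ (W.sum_mem fun i _ => W.smul_mem _ (hb i)))
    rw [h1, h2, h3, Complex.norm_real, Real.norm_eq_abs, sq_abs] at h4
    exact le_of_sq_le_mul_self hs0 (hh.Rren_nonneg x x₀) h4
  have hone : ∀ i, (1 : ℝ≥0∞) ≤ ∑' x, ENNReal.ofReal (V x * ((μ i)⁻¹ * ‖b i x‖ ^ 2)) := by
    intro i
    have h1 := hform _ (hb i)
    rw [he] at h1
    have h2 : ∀ x, ENNReal.ofReal (V x * ((μ i)⁻¹ * ‖b i x‖ ^ 2)) =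
        ENNReal.ofReal (μ i)⁻¹ * ENNReal.ofReal (V x * ‖b i x‖ ^ 2) := fun x => by
      rw [← ENNReal.ofReal_mul (inv_pos.mpr (hμ i)).le]
      congr 1
      ring
    simp only [h2]
    rw [ENNReal.tsum_mul_left]
    calc (1 : ℝ≥0∞) = ENNReal.ofReal (μ i)⁻¹ * ENNReal.ofReal (μ i) := by
          rw [← ENNReal.ofReal_mul (inv_pos.mpr (hμ i)).le, inv_mul_cancel₀ (hμ i).ne',
            ENNReal.ofReal_one]
      _ ≤ _ := by gcongr
  calc (Module.finrank ℂ W : ℝ≥0∞) = ∑ _i : Fin (Module.finrank ℂ W), (1 : ℝ≥0∞) := by simp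
    _ ≤ ∑ i, ∑' x, ENNReal.ofReal (V x * ((μ i)⁻¹ * ‖b i x‖ ^ 2)) :=
        Finset.sum_le_sum fun i _ => hone i
    _ = ∑' x, ∑ i, ENNReal.ofReal (V x * ((μ i)⁻¹ * ‖b i x‖ ^ 2)) :=
        (Summable.tsum_finsetSum fun _ _ => ENNReal.summable).symm
    _ ≤ ∑' x, ENNReal.ofReal (V x * hh.Rren x x₀) := by
        refine ENNReal.tsum_le_tsum fun x => ?_
        rw [← ENNReal.ofReal_sum_of_nonneg fun i _ => ?_, ← Finset.mul_sum]
        · exact ENNReal.ofReal_le_ofReal (mul_le_mul_of_nonneg_left (hbessel x) (hV x))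
        · have := hμ i
          have := hV x
          positivity

/-- The functions of a finite-dimensional space that vanish on a finite set. -/
theorem exists_le_vanishing (W : Submodule ℂ (L2 X)) [FiniteDimensional ℂ W] (S : Finset X) :
    ∃ W' ≤ W, FiniteDimensional ℂ W' ∧ (∀ ψ ∈ W', ∀ x ∈ S, ψ x = 0) ∧
      Module.finrank ℂ W ≤ Module.finrank ℂ W' + S.card := by
  set f : W →ₗ[ℂ] (S → ℂ) :=
    LinearMap.pi fun x : S => (lp.evalCLM ℂ (fun _ : X => ℂ) 2 (x : X)).toLinearMap ∘ₗ W.subtype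
    with hf
  refine ⟨(LinearMap.ker f).map W.subtype, Submodule.map_subtype_le _ _, inferInstance, ?_, ?_⟩
  · rintro _ ⟨ψ, hψ, rfl⟩ x hx
    exact congrFun (LinearMap.mem_ker.mp hψ) ⟨x, hx⟩
  · have h1 := f.finrank_range_add_finrank_ker
    have h2 : Module.finrank ℂ (LinearMap.range f) ≤ S.card := by
      refine (Submodule.finrank_le _).trans ?_
      simp
    rw [Submodule.finrank_map_subtype_eq]
    omega

/-- Vanishing on `S` and at `x₀` costs at most `S.card + 1` dimensions; afterwards `V` may be
replaced by zero on `S`. -/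
theorem finrank_le_of_energy_le (hh : IsMarkovMatrix h) {V : X → ℝ} (hV : ∀ x, 0 ≤ V x)
    (W : Submodule ℂ (L2 X)) [FiniteDimensional ℂ W] (x₀ : X) (S : Finset X)
    (hform : ∀ ψ ∈ W, ENNReal.ofReal (hh.energy ψ) ≤ ∑' x, ENNReal.ofReal (V x * ‖ψ x‖ ^ 2)) :
    (Module.finrank ℂ W : ℝ≥0∞) ≤
      S.card + (∑' x : {x // x ∉ S}, ENNReal.ofReal (V x * hh.Rren x x₀)) + 1 := by
  classical
  obtain ⟨W', hle, hfin, hvan, hcard⟩ := exists_le_vanishing W (insert x₀ S)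
  have h1 : (Module.finrank ℂ W' : ℝ≥0∞) ≤
      ∑' x, ENNReal.ofReal ({x | x ∉ S}.indicator V x * hh.Rren x x₀) := by
    refine hh.finrank_le_tsum_of_vanishing (fun x => Set.indicator_nonneg (fun x _ => hV x) x) W'
      (fun ψ hψ => hvan ψ hψ x₀ (Finset.mem_insert_self _ _)) fun ψ hψ => ?_
    refine (hform ψ (hle hψ)).trans_eq (tsum_congr fun x => ?_)
    by_cases hx : x ∈ S
    · simp [hvan ψ hψ x (Finset.mem_insert_of_mem hx)]
    · rw [Set.indicator_of_mem (s := {x | x ∉ S}) hx]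
  have h2 : ∑' x, ENNReal.ofReal ({x | x ∉ S}.indicator V x * hh.Rren x x₀) =
      ∑' x : {x // x ∉ S}, ENNReal.ofReal (V x * hh.Rren x x₀) := by
    refine Eq.trans (tsum_congr fun x => ?_)
      (tsum_subtype {x | x ∉ S} fun x => ENNReal.ofReal (V x * hh.Rren x x₀)).symm
    by_cases hx : x ∈ S <;> simp [hx]
  have h3 : (Module.finrank ℂ W : ℝ≥0∞) ≤ Module.finrank ℂ W' + (S.card + 1) := by
    have := Finset.card_insert_le x₀ S
    exact_mod_cast hcard.trans (by omega)
  calc (Module.finrank ℂ W : ℝ≥0∞) ≤ Module.finrank ℂ W' + (S.card + 1) := h3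
    _ ≤ (∑' x : {x // x ∉ S}, ENNReal.ofReal (V x * hh.Rren x x₀)) + (S.card + 1) := by
        gcongr
        exact h1.trans_eq h2
    _ = _ := by ring

end IsMarkovMatrix

/-! ### From counting eigenvalues to subspaces with non-positive form -/

section Counting

variable {E : Type*} [NormedAddCommGroup E] [InnerProductSpace ℂ E]

theorem exists_re_inner_nonpos_of_mem_nonposEigenspan {A : E →ₗ.[ℂ] E}
    (hA : ∀ ψ φ : A.domain, ⟪A ψ, (φ : E)⟫_ℂ = ⟪(ψ : E), A φ⟫_ℂ) {u : E}
    (hu : u ∈ nonposEigenspan A) :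
    ∃ ψ : A.domain, (ψ : E) = u ∧ (⟪(ψ : E), A ψ⟫_ℂ).re ≤ 0 := by
  classical
  -- Grouping by eigenvalue makes the components orthogonal by symmetry, so the form is `∑ μ‖ψ_μ‖²`
  -- with no cross terms.
  set K : {μ : ℝ // μ ≤ 0} → Submodule ℂ E := fun μ =>
    (LinearMap.ker (A.toFun - ((μ : ℝ) : ℂ) • A.domain.subtype)).map A.domain.subtype with hK
  have hle : nonposEigenspan A ≤ ⨆ μ, K μ := by
    refine Submodule.span_le.mpr ?_
    rintro _ ⟨μ, ψ, hμ, hψ, rfl⟩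
    refine Submodule.mem_iSup_of_mem (⟨μ, hμ⟩ : {μ : ℝ // μ ≤ 0}) ⟨ψ, ?_, rfl⟩
    exact LinearMap.mem_ker.mpr (sub_eq_zero.mpr hψ)
  obtain ⟨f, hf, rfl⟩ := (Submodule.mem_iSup_iff_exists_finsupp K u).mp (hle hu)
  have hf' : ∀ μ : {μ : ℝ // μ ≤ 0}, ∃ ψ : A.domain, A ψ = ((μ : ℝ) : ℂ) • (ψ : E) ∧ (ψ : E) = f μ := by
    intro μ
    obtain ⟨ψ, h1, h2⟩ := hf μ
    exact ⟨ψ, sub_eq_zero.mp (LinearMap.mem_ker.mp h1), h2⟩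
  choose ψ hψ hψf using hf'
  have horth : ∀ i j, i ≠ j → ⟪(ψ i : E), (ψ j : E)⟫_ℂ = 0 := by
    intro i j hij
    have h1 := hA (ψ i) (ψ j)
    rw [hψ, hψ, inner_smul_left, inner_smul_right, Complex.conj_ofReal] at h1
    by_contra h0
    have h2 := mul_right_cancel₀ h0 h1
    exact hij (Subtype.ext (Complex.ofReal_injective h2))
  refine ⟨∑ i ∈ f.support, ψ i, ?_, ?_⟩
  · rw [Finsupp.sum, AddSubmonoidClass.coe_finsetSum]
    exact Finset.sum_congr rfl fun i _ => hψf i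
  · have h1 : A (∑ i ∈ f.support, ψ i) = ∑ i ∈ f.support, ((i : ℝ) : ℂ) • (ψ i : E) :=
      (map_sum A.toFun ψ f.support).trans (Finset.sum_congr rfl fun i _ => hψ i)
    rw [h1, AddSubmonoidClass.coe_finsetSum, sum_inner, Complex.re_sum]
    refine Finset.sum_nonpos fun i hi => ?_
    rw [inner_sum, Finset.sum_eq_single i (fun j _ hj => by
      rw [inner_smul_right, horth i j hj.symm, mul_zero]) (fun h => absurd hi h),
      inner_smul_right, inner_self_eq_norm_sq_to_K]
    have : (((i : ℝ) : ℂ) * ((‖(ψ i : E)‖ : ℝ) : ℂ) ^ 2).re = (i : ℝ) * ‖(ψ i : E)‖ ^ 2 := by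
      rw [← Complex.ofReal_pow, ← Complex.ofReal_mul, Complex.ofReal_re]
    exact this.trans_le (mul_nonpos_of_nonpos_of_nonneg i.2 (by positivity))

theorem exists_nonpos_subspace_of_isEssentialSpectrum {A : E →ₗ.[ℂ] E} {μ : ℝ} (hμ : μ < 0)
    (hess : IsEssentialSpectrum A μ) (n : ℕ) :
    ∃ W : Submodule ℂ E, FiniteDimensional ℂ W ∧ Module.finrank ℂ W = n ∧
      ∀ u ∈ W, ∃ ψ : A.domain, (ψ : E) = u ∧ (⟪(ψ : E), A ψ⟫_ℂ).re ≤ 0 := by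
  obtain ⟨u, hu, hlim⟩ := hess
  -- The `n` errors of the chosen Weyl vectors then contribute at most `n/(n+1) · |μ| ‖w‖²`, which
  -- `μ‖w‖²` absorbs.
  have hε : 0 < -μ / (n + 1) := div_pos (neg_pos.mpr hμ) (by positivity)
  obtain ⟨k, hk⟩ := eventually_atTop.mp (hlim.eventually (gt_mem_nhds hε))
  set v : Fin n → A.domain := fun i => u (k + i) with hv
  have hvo : Orthonormal ℂ fun i => (v i : E) :=
    hu.comp (fun i : Fin n => k + (i : ℕ)) fun i j hij => Fin.ext (Nat.add_left_cancel hij)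
  refine ⟨Submodule.span ℂ (Set.range fun i => (v i : E)),
    FiniteDimensional.span_of_finite ℂ (Set.finite_range _), ?_, fun w hw => ?_⟩
  · simpa using finrank_span_eq_card hvo.linearIndependent
  obtain ⟨c, rfl⟩ := (Submodule.mem_span_range_iff_exists_fun ℂ).mp hw
  set w : E := ∑ i, c i • (v i : E) with hw'
  have hcoe : ((∑ i, c i • v i : A.domain) : E) = w := by simp [hw']
  refine ⟨∑ i, c i • v i, hcoe, ?_⟩
  have hA : A (∑ i, c i • v i) = (μ : ℂ) • w + ∑ i, c i • (A (v i) - (μ : ℂ) • (v i : E)) := by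
    have h1 : A (∑ i, c i • v i) = ∑ i, c i • A (v i) := by
      refine (map_sum A.toFun _ _).trans (Finset.sum_congr rfl fun i _ => ?_)
      exact map_smul A.toFun _ _
    rw [h1, hw', Finset.smul_sum, ← Finset.sum_add_distrib]
    refine Finset.sum_congr rfl fun i _ => ?_
    rw [smul_sub, smul_comm (μ : ℂ) (c i)]
    abel
  have hcb : ∀ i, ‖c i‖ ≤ ‖w‖ := by
    intro i
    have h1 : ⟪(v i : E), w⟫_ℂ = c i := hvo.inner_right_fintype c i
    rw [← h1]
    simpa [hvo.1 i] using norm_inner_le_norm (𝕜 := ℂ) (v i : E) w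
  have hrem : ‖∑ i, c i • (A (v i) - (μ : ℂ) • (v i : E))‖ ≤ n * (‖w‖ * (-μ / (n + 1))) := by
    refine (norm_sum_le _ _).trans ?_
    calc ∑ i, ‖c i • (A (v i) - (μ : ℂ) • (v i : E))‖ ≤ ∑ _i : Fin n, ‖w‖ * (-μ / (n + 1)) := by
          refine Finset.sum_le_sum fun i _ => ?_
          rw [norm_smul]
          exact mul_le_mul (hcb i) (hk _ (Nat.le_add_right _ _)).le (norm_nonneg _) (norm_nonneg _)
      _ = _ := by simp
  rw [hcoe, hA, inner_add_right, inner_smul_right, inner_self_eq_norm_sq_to_K, Complex.add_re]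
  have h1 : ((μ : ℂ) * ((‖w‖ : ℝ) : ℂ) ^ 2).re = μ * ‖w‖ ^ 2 := by
    rw [← Complex.ofReal_pow, ← Complex.ofReal_mul, Complex.ofReal_re]
  have h2 : (⟪w, ∑ i, c i • (A (v i) - (μ : ℂ) • (v i : E))⟫_ℂ).re ≤
      ‖w‖ * (n * (‖w‖ * (-μ / (n + 1)))) :=
    (Complex.re_le_norm _).trans ((norm_inner_le_norm _ _).trans
      (mul_le_mul_of_nonneg_left hrem (norm_nonneg _)))
  have h3 : ‖w‖ * (n * (‖w‖ * (-μ / (n + 1)))) ≤ -μ * ‖w‖ ^ 2 := by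
    have h4 : (n : ℝ) * (-μ / (n + 1)) ≤ -μ := by
      rw [mul_div_assoc', div_le_iff₀ (by positivity)]
      nlinarith
    nlinarith [mul_le_mul_of_nonneg_right h4 (sq_nonneg ‖w‖)]
  refine (add_le_add h1.le (h2.trans h3)).trans ?_
  linarith

/-- Covers both branches of the count at once; stating it for each natural `n` also handles an
infinite count. -/
theorem exists_nonpos_subspace {A : E →ₗ.[ℂ] E}
    (hA : ∀ ψ φ : A.domain, ⟪A ψ, (φ : E)⟫_ℂ = ⟪(ψ : E), A φ⟫_ℂ) {n : ℕ}
    (hn : (n : ℕ∞) ≤ numNonposEigenvalues A) :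
    ∃ W : Submodule ℂ E, FiniteDimensional ℂ W ∧ Module.finrank ℂ W = n ∧
      ∀ u ∈ W, ∃ ψ : A.domain, (ψ : E) = u ∧ (⟪(ψ : E), A ψ⟫_ℂ).re ≤ 0 := by
  rw [numNonposEigenvalues] at hn
  split_ifs at hn with hess
  · obtain ⟨μ, hμ, hess⟩ := hess
    exact exists_nonpos_subspace_of_isEssentialSpectrum hμ hess n
  · have h1 : (n : Cardinal) ≤ Module.rank ℂ (nonposEigenspan A) := by simpa using hn
    obtain ⟨f, hf⟩ := exists_linearIndependent_of_le_rank h1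
    have hf' : LinearIndependent ℂ fun i => (f i : E) :=
      hf.map' (nonposEigenspan A).subtype (Submodule.ker_subtype _)
    refine ⟨Submodule.span ℂ (Set.range fun i => (f i : E)),
      FiniteDimensional.span_of_finite ℂ (Set.finite_range _), ?_, fun w hw => ?_⟩
    · simpa using finrank_span_eq_card hf'
    · refine exists_re_inner_nonpos_of_mem_nonposEigenspan hA ?_
      refine (Submodule.span_le.mpr ?_ : _ ≤ nonposEigenspan A) hw
      rintro _ ⟨i, rfl⟩
      exact (f i).2

end Counting

theorem enat_toENNReal_le_of_forall {N : ℕ∞} {B : ℝ≥0∞}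
    (hN : ∀ n : ℕ, (n : ℕ∞) ≤ N → (n : ℝ≥0∞) ≤ B) : (N : ℝ≥0∞) ≤ B := by
  induction N using ENat.recTopCoe with
  | top =>
    rw [ENat.toENNReal_top, top_le_iff]
    exact ENNReal.eq_top_of_forall_nnreal_le fun r =>
      (ENNReal.coe_le_coe.mpr (Nat.le_ceil r)).trans (by simpa using hN ⌈r⌉₊ le_top)
  | coe m => simpa using hN m le_rfl

/-! ### Application to the Schrödinger operator -/

namespace IsMarkovMatrix

variable {X : Type*} {h : X → X → ℝ}

theorem exists_schrodinger_eq (hh : IsMarkovMatrix h) (V : X → ℝ) (ψ : (hh.schrodinger V).domain) :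
    ∃ m : L2 X, (∀ x, m x = V x * (ψ : L2 X) x) ∧ hh.schrodinger V ψ = hh.H0 ψ - m :=
  ⟨⟨fun x => (V x : ℂ) * (ψ : L2 X) x, ψ.2⟩, fun _ => rfl, rfl⟩

theorem inner_schrodinger_left (hh : IsMarkovMatrix h) (V : X → ℝ)
    (ψ φ : (hh.schrodinger V).domain) :
    ⟪hh.schrodinger V ψ, (φ : L2 X)⟫_ℂ = ⟪(ψ : L2 X), hh.schrodinger V φ⟫_ℂ := by
  obtain ⟨m, hm, h1⟩ := hh.exists_schrodinger_eq V ψ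
  obtain ⟨k, hk, h2⟩ := hh.exists_schrodinger_eq V φ
  rw [h1, h2, inner_sub_left, inner_sub_right, inner_H0_left]
  congr 1
  refine (lp.hasSum_inner (𝕜 := ℂ) m (φ : L2 X)).unique ?_
  convert lp.hasSum_inner (𝕜 := ℂ) (ψ : L2 X) k using 1
  funext x
  rw [hm, hk, RCLike.inner_apply, RCLike.inner_apply, map_mul, Complex.conj_ofReal]
  ring

theorem energy_le_of_re_inner_nonpos (hh : IsMarkovMatrix h) {V : X → ℝ} (hV : ∀ x, 0 ≤ V x)
    (ψ : (hh.schrodinger V).domain)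
    (hψ : (⟪(ψ : L2 X), hh.schrodinger V ψ⟫_ℂ).re ≤ 0) :
    ENNReal.ofReal (hh.energy ψ) ≤ ∑' x, ENNReal.ofReal (V x * ‖(ψ : L2 X) x‖ ^ 2) := by
  obtain ⟨m, hm, h1⟩ := hh.exists_schrodinger_eq V ψ
  rw [h1, inner_sub_right, Complex.sub_re, sub_nonpos] at hψ
  have h2 := Complex.hasSum_re (lp.hasSum_inner (𝕜 := ℂ) (ψ : L2 X) m)
  have h3 : ∀ x, (inner ℂ ((ψ : L2 X) x) (m x)).re = V x * ‖(ψ : L2 X) x‖ ^ 2 := by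
    intro x
    rw [RCLike.inner_apply, hm, mul_assoc, Complex.mul_conj, Complex.normSq_eq_norm_sq,
      ← Complex.ofReal_mul, Complex.ofReal_re]
  simp only [h3] at h2
  rw [← ENNReal.ofReal_tsum_of_nonneg (fun x => mul_nonneg (hV x) (by positivity)) h2.summable,
    h2.tsum_eq]
  exact ENNReal.ofReal_le_ofReal hψ

theorem N0_le (hh : IsMarkovMatrix h) {V : X → ℝ} (hV : ∀ x, 0 ≤ V x) (x₀ : X) (S : Finset X) :
    (N0 hh V : ℝ≥0∞) ≤
      S.card + (∑' x : {x // x ∉ S}, ENNReal.ofReal (V x * hh.Rren x x₀)) + 1 := by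
  refine enat_toENNReal_le_of_forall fun n hn => ?_
  obtain ⟨W, hfin, rfl, hW⟩ := exists_nonpos_subspace (hh.inner_schrodinger_left V) hn
  refine hh.finrank_le_of_energy_le hV W x₀ S fun u hu => ?_
  obtain ⟨ψ, rfl, hψ⟩ := hW u hu
  exact hh.energy_le_of_re_inner_nonpos hV ψ hψ

end IsMarkovMatrix

end RecurrentCLR

theorem mainTheorem6 {X : Type*} [Countable X] {h : X → X → ℝ}
    (hh : RecurrentCLR.IsMarkovMatrix h) (hrec : hh.IsRecurrent) :
    (∀ x x₀ : X,
      Tendsto (fun lam : ℝ => hh.R0 lam x x₀ ^ 2 / hh.R0 lam x₀ x₀ - hh.R0 lam x x)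
        (𝓝[>] 0) (𝓝 (hh.Rren x x₀))) ∧
    (RecurrentCLR.IsTranslationInvariant h → ∀ x x₀ : X,
      Tendsto (fun lam : ℝ => 2 * (hh.R0 lam x x₀ - hh.R0 lam x₀ x₀))
        (𝓝[>] 0) (𝓝 (hh.Rren x x₀))) ∧
    (∀ x x₀ : X, x ≠ x₀ → 0 < hh.Rren x x₀) ∧
    (∀ x₀ : X, hh.Rren x₀ x₀ = 0) ∧
    (∀ V : X → ℝ, (∀ x, 0 ≤ V x) → ∀ x₀ : X,
      (RecurrentCLR.N0 hh V : ℝ≥0∞) ≤ (∑' x, ENNReal.ofReal (V x * hh.Rren x x₀)) + 1 ∧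
      (RecurrentCLR.N0 hh V : ℝ≥0∞) ≤ ({x | 1 ≤ V x}.encard : ℝ≥0∞) +
        (∑' x : {x // V x < 1}, ENNReal.ofReal (V x * hh.Rren x x₀)) + 1) := by
  refine ⟨hh.tendsto_preRen, hh.tendsto_two_mul_R0_sub hrec, fun x x₀ => hh.Rren_pos, hh.Rren_self,
    fun V hV x₀ => ⟨?_, ?_⟩⟩
  -- The first bound is the case where only vanishing at `x₀` is imposed.
  · have h1 := hh.N0_le hV x₀ ∅
    have h2 := tsum_subtype {x : X | x ∉ (∅ : Finset X)} fun x =>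
      ENNReal.ofReal (V x * hh.Rren x x₀)
    simp only [Finset.notMem_empty, not_false_eq_true, Set.ofPred_true, Set.indicator_univ] at h2
    rw [Finset.card_empty, Nat.cast_zero, zero_add] at h1
    exact h1.trans_eq (congrArg (· + 1) h2)
  · rcases Set.finite_or_infinite {x | 1 ≤ V x} with hfin | hinf
    · have h1 := hh.N0_le hV x₀ hfin.toFinset
      rw [hfin.encard_eq_coe_toFinset_card]
      refine h1.trans_eq ?_
      congr 2
      refine (Equiv.subtypeEquivRight fun x => ?_).tsum_eq (fun x : {x // V x < 1} =>
        ENNReal.ofReal (V x * hh.Rren x x₀))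
      simp
    -- With infinitely many points where `V ≥ 1`, the right-hand side is `∞`.
    · simp [hinf.encard_eq]
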